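/- **Proposition.** Let $U\subseteq\mathbb R^4$ be open (a coordinate chart of spacetime), let $g_{\mu\nu}$ be a smooth Lorentzian metric on $U$ with Levi-Civita connection $\nabla$ and $dV_g=\sqrt{-\det g}\;dt\wedge dx\wedge dy\wedge dz$, and let $f^a{}_{bc}$ be the structure constants of a finite-dimensional real Lie algebra in a basis $(T_a)$ that is orthonormal for an ad-invariant inner product $\delta_{ab}$ (used to raise and lower colour indices). Let $\mathrm g,\xi\in\mathbb R\setminus\{0\}$. Consider the supercommutative algebra of polynomials, with coefficients in $C^\infty(U)$, in the even fields $A^a_\mu$, $b^a$, the odd fields $c^a$ (ghost), $\overline c^a$ (antighost) and all their derivatives. Let $Q$ and $\overline Q$ be the odd left derivations of this algebra that annihilate $C^\infty(U)$, commute with the total derivatives $\partial_\mu$ and satisfy $$QA^a_\mu=\tfrac1\xi\partial_\mu c^a+\mathrm g f^a{}_{bc}c^bA^c_\mu,\quad Qc^a=\tfrac{\mathrm g}2f^a{}_{bc}c^bc^c,\quad Q\overline c^a=\tfrac1\xi b^a,\quad Qb^a=0,$$ $$\overline QA^a_\mu=\tfrac1\xi\partial_\mu\overline c^a+\mathrm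 g f^a{}_{bc}\overline c^bA^c_\mu,\quad \overline Qc^a=-\tfrac1\xi b^a+\mathrm g f^a{}_{bc}\overline c^bc^c,\quad \overline Q\,\overline c^a=\tfrac{\mathrm g}2f^a{}_{bc}\overline c^b\overline c^c,\quad \overline Qb^a=\mathrm g f^a{}_{bc}\overline c^bb^c,$$ and put $\mathcal Q=Q\circ\overline Q$, $L^a=\mathrm g\,g^{\mu\nu}\nabla_\mu A^a_\nu$ and $$G=-\tfrac\xi2\left(\delta_{ab}g^{\mu\nu}A^a_\mu A^b_\nu-\overline c_ac^a\right)dV_g .$$ Write $\simeq$ for equality of Lagrange densities up to a total divergence. Then: 1. $$\mathcal QG\simeq\Big(\tfrac1{2\xi}b_ab^a+\tfrac1{\mathrm g\xi}b_aL^a+\tfrac1\xi g^{\mu\nu}(\partial_\mu\overline c_a)(\partial_\nu c^a)+\mathrm g\,g^{\mu\nu}f^a{}_{bc}(\partial_\mu\overline c_a)c^bA^c_\nu-\tfrac{\mathrm g}2f^a{}_{bc}b_a\overline c^bc^c-\tfrac{\mathrm g^2\xi}8f^a{}_{bc}f_{ade}\overline c^b\overline c^cc^dc^e\Big)dV_g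 .$$ 2. Express $\mathcal QG$ through the shifted auxiliary field $b'^a=b^a-\frac{\mathrm g\xi}2f^a{}_{bc}\overline c^bc^c$ by substituting $b^a=b'^a+\frac{\mathrm g\xi}2f^a{}_{bc}\overline c^bc^c$. The Euler–Lagrange equation of $b'$ for the resulting density has the unique solution $b'^a=-\frac1{\mathrm g}L^a$. 3. Inserting this solution gives the symmetric gauge fixing and ghost Lagrange density $$\begin{aligned}\mathcal L_{\text{YM-GF-Ghost}}\simeq{}&\tfrac1\xi\Big(-\tfrac1{2\mathrm g^2}\delta_{ab}L^aL^b+g^{\mu\nu}(\partial_\mu\overline c_a)(\partial_\nu c^a)\Big)dV_g\\&+\tfrac{\mathrm g}2g^{\mu\nu}f^a{}_{bc}\Big((\partial_\mu\overline c_a)c^bA^c_\nu-\overline c_a(\partial_\mu c^b)A^c_\nu\Big)dV_g-\tfrac{\mathrm g^2\xi}{16}f^a{}_{bc}f_{ade}\overline c^b\overline c^cc^dc^e\,dV_g .\end{aligned}$$ -/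

import Mathlib

open scoped ContDiff TensorProduct

noncomputable section

namespace QYM

/-! ## Smooth functions on a coordinate chart of spacetime -/

/-- Coordinates `(t, x, y, z)`. -/
abbrev Coord : Type := Fin 4 → ℝ

/-- A function on the open set `U`, extended by zero to all of `ℝ⁴`. -/
def extendZero {U : TopologicalSpace.Opens Coord} (h : U → ℝ) : Coord → ℝ :=
  Function.extend Subtype.val h 0

theorem extendZero_apply {U : TopologicalSpace.Opens Coord} (h : U → ℝ) (x : U) :
    extendZero h x = h x :=
  Subtype.val_injective.extend_apply h 0 x

theorem contDiffOn_extendZero {U : TopologicalSpace.Opens Coord} {h : U → ℝ} {F : Coord → ℝ}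
    (hF : ContDiffOn ℝ ∞ F U) (hh : ∀ x : U, h x = F x) : ContDiffOn ℝ ∞ (extendZero h) U :=
  hF.congr fun x hx => by rw [← hh ⟨x, hx⟩]; exact extendZero_apply h ⟨x, hx⟩

/-- The `ℝ`-algebra of smooth real functions on the open set `U ⊆ ℝ⁴`. -/
def SmoothFun (U : TopologicalSpace.Opens Coord) : Subalgebra ℝ (U → ℝ) where
  carrier := {h | ContDiffOn ℝ ∞ (extendZero h) U}
  mul_mem' {a b} ha hb := contDiffOn_extendZero (ha.mul hb) fun x => by
    simp [extendZero_apply]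
  add_mem' {a b} ha hb := contDiffOn_extendZero (ha.add hb) fun x => by
    simp [extendZero_apply]
  algebraMap_mem' r := contDiffOn_extendZero (F := fun _ => r) contDiffOn_const fun x => by
    simp

theorem SmoothFun.differentiableAt {U : TopologicalSpace.Opens Coord} (h : SmoothFun U) (x : U) :
    DifferentiableAt ℝ (extendZero h.1) x :=
  ((h.2.contDiffAt (U.isOpen.mem_nhds x.2)).differentiableAt (by simp))

theorem fderiv_extendZero_congr {U : TopologicalSpace.Opens Coord} {h : U → ℝ} {F : Coord → ℝ}
    (hh : ∀ x : U, h x = F x) (x : U) : fderiv ℝ (extendZero h) x = fderiv ℝ F x := by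
  apply Filter.EventuallyEq.fderiv_eq
  filter_upwards [U.isOpen.mem_nhds x.2] with y hy
  rw [← hh ⟨y, hy⟩]; exact extendZero_apply h ⟨y, hy⟩

/-- The coordinate derivative `∂_μ` of smooth functions on `U`. -/
def partialDeriv {U : TopologicalSpace.Opens Coord} (μ : Fin 4) :
    SmoothFun U →ₗ[ℝ] SmoothFun U where
  toFun h := ⟨fun x => fderiv ℝ (extendZero h.1) x (Pi.single μ 1),
    contDiffOn_extendZero (F := fun x => fderiv ℝ (extendZero h.1) x (Pi.single μ 1))
      ((h.2.fderiv_of_isOpen U.isOpen (by simp)).clm_apply contDiffOn_const) fun _ => rfl⟩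
  map_add' a b := by
    ext x
    have : fderiv ℝ (extendZero (a + b).1) x =
        fderiv ℝ (fun y => extendZero a.1 y + extendZero b.1 y) x :=
      fderiv_extendZero_congr (fun x => by simp [extendZero_apply]) x
    simp only [this]
    rw [fderiv_fun_add (SmoothFun.differentiableAt a x) (SmoothFun.differentiableAt b x)]
    rfl
  map_smul' r a := by
    ext x
    have : fderiv ℝ (extendZero (r • a).1) x =
        fderiv ℝ (fun y => r • extendZero a.1 y) x :=
      fderiv_extendZero_congr (fun x => by simp [extendZero_apply]) x
    simp only [this]
    rw [fderiv_fun_const_smul (SmoothFun.differentiableAt a x)]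
    rfl

/-- A Lorentzian metric on `U`: a smooth symmetric matrix `g_{μν}` with negative determinant
(in dimension four this means exactly that the signature is `(1, 3)` or `(3, 1)`). -/
structure LorentzMetric (U : TopologicalSpace.Opens Coord) where
  /-- the components `g_{μν}` -/
  comp : Matrix (Fin 4) (Fin 4) (SmoothFun U)
  symm : comp.IsSymm
  det_neg : ∀ x : U, (comp.det : U → ℝ) x < 0

namespace LorentzMetric

variable {U : TopologicalSpace.Opens Coord} (m : LorentzMetric U)

/-- The inverse metric `g^{μν}`. -/
def inv (μ ν : Fin 4) : SmoothFun U := m.comp⁻¹ μ ν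

/-- `√(-det g)`, the coefficient of the volume form `dV_g` with respect to `dt ∧ dx ∧ dy ∧ dz`. -/
def vol : SmoothFun U :=
  ⟨fun x => √(-(m.comp.det : U → ℝ) x),
    contDiffOn_extendZero (F := fun x => √(-extendZero m.comp.det.1 x))
      (m.comp.det.2.neg.sqrt fun x hx => by
        have := m.det_neg ⟨x, hx⟩
        rw [extendZero_apply m.comp.det.1 ⟨x, hx⟩]
        exact (neg_pos.mpr this).ne')
      fun x => by rw [extendZero_apply]⟩

/-- The Christoffel symbols `Γ^ρ_{μν}` of the Levi-Civita connection. -/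
def christoffel (ρ μ ν : Fin 4) : SmoothFun U :=
  (1 / 2 : ℝ) • ∑ σ, m.inv ρ σ * (partialDeriv μ (m.comp σ ν) + partialDeriv ν (m.comp σ μ)
    - partialDeriv σ (m.comp μ ν))

end LorentzMetric

/-! ## The free supercommutative algebra on the jets of the fields -/

/-- The components of the fields: the gauge field `A^a_μ`, the ghost `c^a`, the antighost `c̄^a`
and the Lautrup–Nakanishi auxiliary field `b^a`, where `a` runs over the colour indices `ι`. -/
inductive FieldComp (ι : Type*)
  | gaugeField (μ : Fin 4) (a : ι)
  | ghost (a : ι)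
  | antighost (a : ι)
  | aux (a : ι)

/-- The parity: ghost and antighost are odd, gauge field and auxiliary field are even. -/
def FieldComp.parity {ι : Type*} : FieldComp ι → ℕ
  | .gaugeField _ _ => 0
  | .ghost _ => 1
  | .antighost _ => 1
  | .aux _ => 0

/-- A jet coordinate `∂_I φ`: a field component together with a multi-index of derivatives. -/
abbrev Jet (ι : Type*) : Type _ := FieldComp ι × (Fin 4 → ℕ)

/-- The supercommutation relations `u v = (-1)^{|u||v|} v u` between jet coordinates. -/
inductive SuperRel (ι : Type*) : FreeAlgebra ℝ (Jet ι) → FreeAlgebra ℝ (Jet ι) → Prop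
  | swap (u v : Jet ι) : SuperRel ι (FreeAlgebra.ι ℝ u * FreeAlgebra.ι ℝ v)
      ((-1 : ℝ) ^ (u.1.parity * v.1.parity) • (FreeAlgebra.ι ℝ v * FreeAlgebra.ι ℝ u))

/-- The free supercommutative `ℝ`-algebra on the jet coordinates. -/
def JetAlg (ι : Type*) : Type _ := RingQuot (SuperRel ι)

instance (ι : Type*) : Ring (JetAlg ι) := inferInstanceAs (Ring (RingQuot (SuperRel ι)))

instance (ι : Type*) : Algebra ℝ (JetAlg ι) :=
  inferInstanceAs (Algebra ℝ (RingQuot (SuperRel ι)))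

section JetAlg

variable {ι : Type*}

/-- A jet coordinate as an element of the jet algebra. -/
def jet (u : Jet ι) : JetAlg ι := RingQuot.mkAlgHom ℝ (SuperRel ι) (FreeAlgebra.ι ℝ u)

theorem jet_mul_jet (u v : Jet ι) :
    jet u * jet v = (-1 : ℝ) ^ (u.1.parity * v.1.parity) • (jet v * jet u) := by
  have := RingQuot.mkAlgHom_rel ℝ (SuperRel.swap u v)
  rw [map_mul, map_smul, map_mul] at this
  exact this

/-- The algebra homomorphism with prescribed supercommuting values on the jet coordinates. -/
def jetLift {B : Type*} [Ring B] [Algebra ℝ B] (v : Jet ι → B)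
    (hv : ∀ s t, v s * v t = (-1 : ℝ) ^ (s.1.parity * t.1.parity) • (v t * v s)) :
    JetAlg ι →ₐ[ℝ] B :=
  RingQuot.liftAlgHom ℝ ⟨FreeAlgebra.lift ℝ v, by
    rintro _ _ ⟨s, t⟩
    simpa using hv s t⟩

theorem jetLift_jet {B : Type*} [Ring B] [Algebra ℝ B] (v : Jet ι → B)
    (hv : ∀ s t, v s * v t = (-1 : ℝ) ^ (s.1.parity * t.1.parity) • (v t * v s)) (u : Jet ι) :
    jetLift v hv (jet u) = v u := by
  have : (RingQuot.liftAlgHom ℝ ⟨FreeAlgebra.lift ℝ v, fun a b h => by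
      obtain ⟨s, t⟩ := h; simpa using hv s t⟩) (RingQuot.mkAlgHom ℝ (SuperRel ι)
      (FreeAlgebra.ι ℝ u)) = v u := by simp
  exact this

theorem jet_induction {P : JetAlg ι → Prop} (hc : ∀ r : ℝ, P (algebraMap ℝ _ r))
    (hj : ∀ u, P (jet u)) (hm : ∀ x y, P x → P y → P (x * y))
    (ha : ∀ x y, P x → P y → P (x + y)) (x : JetAlg ι) : P x := by
  obtain ⟨y, rfl⟩ := RingQuot.mkAlgHom_surjective ℝ (SuperRel ι) x
  induction y using FreeAlgebra.induction with
  | grade0 r => rw [AlgHom.commutes]; exact hc r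
  | grade1 u => exact hj u
  | mul a b ha' hb' => rw [map_mul]; exact hm _ _ ha' hb'
  | add a b ha' hb' => rw [map_add]; exact ha _ _ ha' hb'

/-- The parity automorphism: `1` on even and `-1` on odd elements. -/
def parityHom : JetAlg ι →ₐ[ℝ] JetAlg ι :=
  jetLift (fun u => (-1 : ℝ) ^ u.1.parity • jet u) fun s t => by
    simp only [smul_mul_smul_comm, jet_mul_jet s t, smul_smul]
    congr 1
    ring

theorem parityHom_jet (u : Jet ι) : parityHom (jet u) = (-1 : ℝ) ^ u.1.parity • jet u :=
  jetLift_jet _ _ u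

theorem parityHom_pow_jet (p : ℕ) (u : Jet ι) :
    (parityHom ^ p) (jet u) = (-1 : ℝ) ^ (p * u.1.parity) • jet u := by
  induction p with
  | zero => simp
  | succ n ih =>
    rw [pow_succ', AlgHom.mul_apply, ih, map_smul, parityHom_jet, smul_smul]
    congr 1
    ring

theorem jet_mul (u : Jet ι) (x : JetAlg ι) :
    jet u * x = (parityHom ^ u.1.parity) x * jet u := by
  induction x using jet_induction with
  | hc r => simp [Algebra.commutes]
  | hj v => rw [parityHom_pow_jet, jet_mul_jet, smul_mul_assoc]
  | hm x y hx hy => rw [← mul_assoc, hx, mul_assoc, hy, map_mul, mul_assoc]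
  | ha x y hx hy => rw [mul_add, hx, hy, map_add, add_mul]

theorem parityHom_pow_of_homogeneous {x : JetAlg ι} {k : ℕ}
    (hx : parityHom x = (-1 : ℝ) ^ k • x) (p : ℕ) :
    (parityHom ^ p) x = (-1 : ℝ) ^ (p * k) • x := by
  induction p with
  | zero => simp
  | succ n ih =>
    rw [pow_succ', AlgHom.mul_apply, ih, map_smul, hx, smul_smul]
    congr 1
    ring

/-- The algebra homomorphism `x ↦ ((σ^p x, d x), (0, x))` that encodes the left superderivation
`d` of parity `p` with `d u = v u` on jet coordinates; here `σ` is the parity automorphism. -/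
def superDerHom (p : ℕ) (v : Jet ι → JetAlg ι)
    (hv : ∀ u, parityHom (v u) = (-1 : ℝ) ^ (p + u.1.parity) • v u) :
    JetAlg ι →ₐ[ℝ] Matrix (Fin 2) (Fin 2) (JetAlg ι) :=
  jetLift (fun u => !![(parityHom ^ p) (jet u), v u; 0, jet u]) fun s t => by
    have key : ∀ s t : Jet ι, (parityHom ^ p) (jet s) * v t =
        (-1 : ℝ) ^ (s.1.parity * t.1.parity) • (v t * jet s) := fun s t => by
      rw [parityHom_pow_jet, smul_mul_assoc, jet_mul, parityHom_pow_of_homogeneous (hv t),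
        smul_mul_assoc, smul_smul]
      congr 1
      rw [← pow_add, show p * s.1.parity + s.1.parity * (p + t.1.parity)
        = 2 * (p * s.1.parity) + s.1.parity * t.1.parity by ring, pow_add, pow_mul]
      simp
    have key' : v s * jet t =
        (-1 : ℝ) ^ (s.1.parity * t.1.parity) • ((parityHom ^ p) (jet t) * v s) := by
      rw [key t s, smul_smul, ← pow_add, mul_comm t.1.parity, ← two_mul, pow_mul]
      simp
    rw [Matrix.mul_fin_two, Matrix.mul_fin_two, Matrix.smul_of]
    congr 1
    simp only [Matrix.smul_cons, Matrix.smul_empty, mul_zero, zero_mul, add_zero, zero_add,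
      smul_zero, smul_add]
    rw [← key', key s t, jet_mul_jet s t, ← map_mul, jet_mul_jet s t, map_smul, map_mul,
      add_comm (v s * jet t)]

/-- The left superderivation `d` of the jet algebra of parity `p` (`0` even, `1` odd) that is
prescribed by `d u = v u` on jet coordinates:
`d (x y) = (d x) y + σ^p(x) (d y)`. -/
def superDer (p : ℕ) (v : Jet ι → JetAlg ι)
    (hv : ∀ u, parityHom (v u) = (-1 : ℝ) ^ (p + u.1.parity) • v u) :
    JetAlg ι →ₗ[ℝ] JetAlg ι where
  toFun x := superDerHom p v hv x 0 1
  map_add' x y := by simp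
  map_smul' r x := by simp

section superDer

variable (p : ℕ) (v : Jet ι → JetAlg ι)
  (hv : ∀ u, parityHom (v u) = (-1 : ℝ) ^ (p + u.1.parity) • v u)

theorem superDer_jet (u : Jet ι) : superDer p v hv (jet u) = v u := by
  simp [superDer, superDerHom, jetLift_jet]

theorem superDerHom_diag (x : JetAlg ι) :
    superDerHom p v hv x 0 0 = (parityHom ^ p) x ∧ superDerHom p v hv x 1 0 = 0 ∧
      superDerHom p v hv x 1 1 = x := by
  induction x using jet_induction with
  | hc r => simp [Matrix.algebraMap_matrix_apply]
  | hj u => simp [superDerHom, jetLift_jet]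
  | hm x y hx hy => simp [Matrix.mul_apply, Fin.sum_univ_two, hx, hy]
  | ha x y hx hy => simp [hx, hy]

theorem superDer_mul (x y : JetAlg ι) :
    superDer p v hv (x * y) = superDer p v hv x * y + (parityHom ^ p) x * superDer p v hv y := by
  have hx := superDerHom_diag p v hv x
  have hy := superDerHom_diag p v hv y
  simp only [superDer, LinearMap.coe_mk, AddHom.coe_mk, map_mul, Matrix.mul_apply,
    Fin.sum_univ_two, hx.1, hy.2.2]
  rw [add_comm]

theorem superDer_algebraMap (r : ℝ) : superDer p v hv (algebraMap ℝ _ r) = 0 := by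
  simp [superDer, Matrix.algebraMap_matrix_apply]

theorem parityHom_superDer (x : JetAlg ι) :
    parityHom (superDer p v hv x) = (-1 : ℝ) ^ p • superDer p v hv (parityHom x) := by
  have comm : ∀ x : JetAlg ι, parityHom ((parityHom ^ p) x) = (parityHom ^ p) (parityHom x) :=
    fun x => by rw [← AlgHom.mul_apply, ← AlgHom.mul_apply, ← pow_succ', pow_succ]
  induction x using jet_induction with
  | hc r => simp [superDer_algebraMap]
  | hj u =>
    rw [superDer_jet, hv, parityHom_jet, map_smul, superDer_jet, smul_smul, pow_add]
  | hm x y hx hy =>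
    simp only [superDer_mul, map_add, map_mul, hx, hy, comm, smul_add, smul_mul_assoc,
      mul_smul_comm]
  | ha x y hx hy => simp [hx, hy]

end superDer

/-- The iterated derivative `D^I = D_0^{I 0} D_1^{I 1} D_2^{I 2} D_3^{I 3}`. -/
def iterD {M : Type*} [AddCommMonoid M] [Module ℝ M] (D : Fin 4 → Module.End ℝ M)
    (I : Fin 4 → ℕ) : Module.End ℝ M :=
  (List.ofFn fun μ => D μ ^ I μ).prod

theorem iterD_comm {M : Type*} [AddCommMonoid M] [Module ℝ M] {D : Fin 4 → Module.End ℝ M}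
    {S : Module.End ℝ M} (h : ∀ μ, Commute S (D μ)) (I : Fin 4 → ℕ) :
    Commute S (iterD D I) := by
  apply Commute.list_prod_right
  intro y hy
  obtain ⟨μ, rfl⟩ := (List.mem_ofFn' _ _).mp hy
  exact (h μ).pow_right _

/-- The derivative `∂_μ` on the jet algebra: the even derivation with `∂_μ (∂_I φ) = ∂_{I+μ} φ`. -/
def jetD (μ : Fin 4) : JetAlg ι →ₗ[ℝ] JetAlg ι :=
  superDer 0 (fun u => jet (u.1, u.2 + Pi.single μ 1)) fun u => by
    rw [parityHom_jet, zero_add]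

theorem parityHom_jetD (μ : Fin 4) :
    Commute (parityHom (ι := ι)).toLinearMap (jetD μ : Module.End ℝ (JetAlg ι)) :=
  LinearMap.ext fun x => by
    simpa [jetD] using parityHom_superDer 0 _ _ x

theorem parityHom_iterD (I : Fin 4 → ℕ) (x : JetAlg ι) :
    parityHom (iterD jetD I x) = iterD jetD I (parityHom x) :=
  LinearMap.congr_fun (iterD_comm (parityHom_jetD (ι := ι)) I) x

/-- The (prolonged, evolutionary) super vector field of parity `p` with characteristic `q`:
the left superderivation with `φ ↦ q φ` that commutes with the derivatives, i.e.
`∂_I φ ↦ ∂_I (q φ)`. -/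
def evolutionary (p : ℕ) (q : FieldComp ι → JetAlg ι)
    (hq : ∀ φ, parityHom (q φ) = (-1 : ℝ) ^ (p + φ.parity) • q φ) :
    JetAlg ι →ₗ[ℝ] JetAlg ι :=
  superDer p (fun u => iterD jetD u.2 (q u.1)) fun u => by
    rw [parityHom_iterD, hq, map_smul]

/-- The field component `φ` itself, as an element of the jet algebra. -/
def fld (φ : FieldComp ι) : JetAlg ι := jet (φ, 0)

theorem parityHom_fld (φ : FieldComp ι) : parityHom (fld φ) = (-1 : ℝ) ^ φ.parity • fld φ :=
  parityHom_jet _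

/-- The bracket `[X, Y]^a = f^a_{bc} X^b Y^c`. -/
def bracket [Fintype ι] (f : ι → ι → ι → ℝ) {B : Type*} [Ring B] [Algebra ℝ B]
    (X Y : ι → B) (a : ι) : B :=
  ∑ b, ∑ c, f a b c • (X b * Y c)

theorem map_bracket [Fintype ι] (f : ι → ι → ι → ℝ) {B B' : Type*} [Ring B] [Algebra ℝ B]
    [Ring B'] [Algebra ℝ B'] (h : B →ₐ[ℝ] B') (X Y : ι → B) (a : ι) :
    h (bracket f X Y a) = bracket f (fun b => h (X b)) (fun b => h (Y b)) a := by
  simp [bracket]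

theorem bracket_smul [Fintype ι] (f : ι → ι → ι → ℝ) {B : Type*} [Ring B] [Algebra ℝ B]
    (r s : ℝ) (X Y : ι → B) (a : ι) :
    bracket f (fun b => r • X b) (fun b => s • Y b) a = (r * s) • bracket f X Y a := by
  simp only [bracket, smul_mul_smul_comm, Finset.smul_sum]
  refine Finset.sum_congr rfl fun b _ => Finset.sum_congr rfl fun c _ => ?_
  rw [smul_comm]

theorem parityHom_bracket_fld [Fintype ι] (f : ι → ι → ι → ℝ) (X Y : ι → FieldComp ι)
    (k l : ℕ) (hX : ∀ b, (X b).parity = k) (hY : ∀ b, (Y b).parity = l) (a : ι) :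
    parityHom (bracket f (fun b => fld (X b)) (fun b => fld (Y b)) a) =
      (-1 : ℝ) ^ (k + l) • bracket f (fun b => fld (X b)) (fun b => fld (Y b)) a := by
  rw [map_bracket]
  simp only [parityHom_fld, hX, hY]
  rw [bracket_smul, pow_add]

/-! ## The gauge BRST and anti-BRST operators -/

open FieldComp

theorem parityHom_jetD_fld (μ : Fin 4) (φ : FieldComp ι) :
    parityHom (jetD μ (fld φ)) = (-1 : ℝ) ^ φ.parity • jetD μ (fld φ) := by
  have := LinearMap.congr_fun (parityHom_jetD (ι := ι) μ) (fld φ)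
  simpa [parityHom_fld] using this

section BRST

variable [Fintype ι] (f : ι → ι → ι → ℝ) (gc ξ : ℝ)

/-- The characteristic of the gauge BRST operator (coupling constant `gc`, gauge parameter `ξ`):
`Q A^a_μ = ξ⁻¹ ∂_μ c^a + gc f^a_{bc} c^b A^c_μ`, `Q c^a = (gc/2) f^a_{bc} c^b c^c`,
`Q c̄^a = ξ⁻¹ b^a`, `Q b^a = 0`. -/
def brstChar : FieldComp ι → JetAlg ι
  | gaugeField μ a => (1 / ξ) • jetD μ (fld (ghost a)) +
      gc • bracket f (fun b => fld (ghost b)) (fun c => fld (gaugeField μ c)) a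
  | ghost a => (gc / 2) • bracket f (fun b => fld (ghost b)) (fun c => fld (ghost c)) a
  | antighost a => (1 / ξ) • fld (aux a)
  | aux _ => 0

/-- The characteristic of the gauge anti-BRST operator:
`Q̄ A^a_μ = ξ⁻¹ ∂_μ c̄^a + gc f^a_{bc} c̄^b A^c_μ`, `Q̄ c^a = -ξ⁻¹ b^a + gc f^a_{bc} c̄^b c^c`,
`Q̄ c̄^a = (gc/2) f^a_{bc} c̄^b c̄^c`, `Q̄ b^a = gc f^a_{bc} c̄^b b^c`. -/
def antiBrstChar : FieldComp ι → JetAlg ι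
  | gaugeField μ a => (1 / ξ) • jetD μ (fld (antighost a)) +
      gc • bracket f (fun b => fld (antighost b)) (fun c => fld (gaugeField μ c)) a
  | ghost a => -((1 / ξ) • fld (aux a)) +
      gc • bracket f (fun b => fld (antighost b)) (fun c => fld (ghost c)) a
  | antighost a =>
      (gc / 2) • bracket f (fun b => fld (antighost b)) (fun c => fld (antighost c)) a
  | aux a => gc • bracket f (fun b => fld (antighost b)) (fun c => fld (aux c)) a

theorem brstChar_parity (φ : FieldComp ι) :
    parityHom (brstChar f gc ξ φ) = (-1 : ℝ) ^ (1 + φ.parity) • brstChar f gc ξ φ := by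
  cases φ with
  | gaugeField μ a =>
    simp only [brstChar, map_add, map_smul, parityHom_jetD_fld,
      parityHom_bracket_fld f ghost (gaugeField μ) 1 0 (fun _ => rfl) (fun _ => rfl), parity]
    module
  | ghost a =>
    simp only [brstChar, map_smul,
      parityHom_bracket_fld f ghost ghost 1 1 (fun _ => rfl) (fun _ => rfl), parity]
    module
  | antighost a => simp only [brstChar, map_smul, parityHom_fld, parity]; module
  | aux a => simp [brstChar]

theorem antiBrstChar_parity (φ : FieldComp ι) :
    parityHom (antiBrstChar f gc ξ φ) = (-1 : ℝ) ^ (1 + φ.parity) • antiBrstChar f gc ξ φ := by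
  cases φ with
  | gaugeField μ a =>
    simp only [antiBrstChar, map_add, map_smul, parityHom_jetD_fld,
      parityHom_bracket_fld f antighost (gaugeField μ) 1 0 (fun _ => rfl) (fun _ => rfl), parity]
    module
  | ghost a =>
    simp only [antiBrstChar, map_add, map_neg, map_smul, parityHom_fld,
      parityHom_bracket_fld f antighost ghost 1 1 (fun _ => rfl) (fun _ => rfl), parity]
    module
  | antighost a =>
    simp only [antiBrstChar, map_smul,
      parityHom_bracket_fld f antighost antighost 1 1 (fun _ => rfl) (fun _ => rfl), parity]
    module
  | aux a =>
    simp only [antiBrstChar, map_smul,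
      parityHom_bracket_fld f antighost aux 1 0 (fun _ => rfl) (fun _ => rfl), parity]
    module

end BRST

end JetAlg

/-! ## Local densities over the chart `U` -/

/-- The algebra of local expressions on `U`: polynomials in the jets of the fields with smooth
functions on `U` as coefficients. A Lagrange density is identified with its coefficient with
respect to `dt ∧ dx ∧ dy ∧ dz`. -/
abbrev LocalAlg (U : TopologicalSpace.Opens Coord) (ι : Type*) : Type _ :=
  SmoothFun U ⊗[ℝ] JetAlg ι

instance (U : TopologicalSpace.Opens Coord) (ι : Type*) : Ring (LocalAlg U ι) :=
  Algebra.TensorProduct.instRing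

instance (U : TopologicalSpace.Opens Coord) (ι : Type*) : Algebra ℝ (LocalAlg U ι) :=
  Algebra.TensorProduct.instAlgebra

section LocalAlg

variable {U : TopologicalSpace.Opens Coord} {ι : Type*}

/-- A smooth function as a local expression. -/
def coeff (h : SmoothFun U) : LocalAlg U ι := h ⊗ₜ 1

/-- A field component as a local expression. -/
def field (φ : FieldComp ι) : LocalAlg U ι := 1 ⊗ₜ fld φ

/-- The total derivative `∂_μ` of local expressions. -/
def totalD (μ : Fin 4) : LocalAlg U ι →ₗ[ℝ] LocalAlg U ι :=
  (partialDeriv μ).rTensor (JetAlg ι) + (jetD μ).lTensor (SmoothFun U)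

/-- Equality of Lagrange densities up to a total divergence. -/
def EqModDiv (X Y : LocalAlg U ι) : Prop :=
  ∃ J : Fin 4 → LocalAlg U ι, X - Y = ∑ μ, totalD μ (J μ)

/-- The parity automorphism on local expressions. -/
def parityLoc : LocalAlg U ι →ₐ[ℝ] LocalAlg U ι :=
  Algebra.TensorProduct.map (AlgHom.id ℝ _) parityHom

/-- The even local expressions. -/
def evenPart (U : TopologicalSpace.Opens Coord) (ι : Type*) : Subalgebra ℝ (LocalAlg U ι) :=
  AlgHom.equalizer parityLoc (AlgHom.id ℝ _)

/-- The gauge BRST operator `Q` on local expressions: it annihilates the coefficient functions,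
in particular the metric. -/
def brst [Fintype ι] (f : ι → ι → ι → ℝ) (gc ξ : ℝ) : LocalAlg U ι →ₗ[ℝ] LocalAlg U ι :=
  (evolutionary 1 (brstChar f gc ξ) (brstChar_parity f gc ξ)).lTensor (SmoothFun U)

/-- The gauge anti-BRST operator `Q̄` on local expressions. -/
def antiBrst [Fintype ι] (f : ι → ι → ι → ℝ) (gc ξ : ℝ) : LocalAlg U ι →ₗ[ℝ] LocalAlg U ι :=
  (evolutionary 1 (antiBrstChar f gc ξ) (antiBrstChar_parity f gc ξ)).lTensor (SmoothFun U)

/-- The gauge super-BRST operator `𝒬 = Q ∘ Q̄`. -/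
def superBrst [Fintype ι] (f : ι → ι → ι → ℝ) (gc ξ : ℝ) : LocalAlg U ι →ₗ[ℝ] LocalAlg U ι :=
  brst f gc ξ ∘ₗ antiBrst f gc ξ

/-! ### Euler–Lagrange derivative and substitution for the auxiliary field -/

open Classical in
/-- The partial derivative with respect to the jet coordinate `∂_I b^a`. -/
def auxPartial (a : ι) (I : Fin 4 → ℕ) : LocalAlg U ι →ₗ[ℝ] LocalAlg U ι :=
  (superDer 0 (fun u => if u = (FieldComp.aux a, I) then 1 else 0) fun u => by
    split_ifs with h
    · subst h; simp [FieldComp.parity]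
    · simp).lTensor (SmoothFun U)

/-- The Euler–Lagrange derivative with respect to `b^a`,
`∑_I (-1)^{|I|} ∂_I (∂X / ∂(∂_I b^a))`; only finitely many summands are non-zero. -/
def eulerAux (a : ι) (X : LocalAlg U ι) : LocalAlg U ι :=
  ∑ᶠ I : Fin 4 → ℕ, (-1 : ℝ) ^ (∑ μ, I μ) • iterD totalD I (auxPartial a I X)

theorem parityLoc_totalD (μ : Fin 4) :
    Commute (parityLoc (U := U) (ι := ι)).toLinearMap
      (totalD μ : Module.End ℝ (LocalAlg U ι)) := by
  refine TensorProduct.ext' fun h x => ?_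
  have := LinearMap.congr_fun (parityHom_jetD (ι := ι) μ) x
  simp only [Module.End.mul_apply, AlgHom.toLinearMap_apply] at this
  simp [parityLoc, totalD, this]

theorem parityLoc_iterD (I : Fin 4 → ℕ) (x : LocalAlg U ι) :
    parityLoc (iterD totalD I x) = iterD totalD I (parityLoc x) :=
  LinearMap.congr_fun (iterD_comm (parityLoc_totalD (U := U) (ι := ι)) I) x

theorem coeff_commute (h : SmoothFun U) (y : LocalAlg U ι) : Commute (coeff h) y := by
  induction y using TensorProduct.induction_on with
  | zero => exact Commute.zero_right _
  | tmul k z => simp [coeff, Commute, SemiconjBy, mul_comm]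
  | add y z hy hz => exact hy.add_right hz

theorem even_commute {x : LocalAlg U ι} (hx : parityLoc x = x) (y : LocalAlg U ι) :
    Commute x y := by
  have swap : ∀ (u : Jet ι) (z : LocalAlg U ι),
      (1 ⊗ₜ jet u : LocalAlg U ι) * z = (parityLoc ^ u.1.parity) z * (1 ⊗ₜ jet u) := by
    intro u z
    have hp : ∀ (p : ℕ) (h : SmoothFun U) (w : JetAlg ι),
        (parityLoc ^ p) (h ⊗ₜ[ℝ] w) = h ⊗ₜ (parityHom ^ p) w := by
      intro p h w
      induction p with
      | zero => simp
      | succ n ih => rw [pow_succ', AlgHom.mul_apply, ih, pow_succ', AlgHom.mul_apply]; rfl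
    induction z using TensorProduct.induction_on with
    | zero => simp
    | tmul h w => rw [hp]; simp [jet_mul u w]
    | add y z hy hz => rw [mul_add, hy, hz, map_add, add_mul]
  have hpow : ∀ p : ℕ, (parityLoc ^ p) x = x := by
    intro p
    induction p with
    | zero => simp
    | succ n ih => rw [pow_succ', AlgHom.mul_apply, ih, hx]
  have hj : ∀ w : JetAlg ι, Commute x (1 ⊗ₜ w : LocalAlg U ι) := by
    intro w
    induction w using jet_induction with
    | hc r =>
      have : (1 ⊗ₜ algebraMap ℝ (JetAlg ι) r : LocalAlg U ι) = algebraMap ℝ _ r := by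
        rw [Algebra.TensorProduct.algebraMap_apply, Algebra.algebraMap_eq_smul_one,
          Algebra.algebraMap_eq_smul_one, TensorProduct.tmul_smul, TensorProduct.smul_tmul']
      rw [this]
      exact (Algebra.commutes r x).symm
    | hj u =>
      have := swap u x
      rw [hpow] at this
      exact this.symm
    | hm w z hw hz =>
      have : (1 ⊗ₜ (w * z) : LocalAlg U ι) = (1 ⊗ₜ w) * (1 ⊗ₜ z) := by simp
      rw [this]
      exact hw.mul_right hz
    | ha w z hw hz =>
      rw [TensorProduct.tmul_add]
      exact hw.add_right hz
  induction y using TensorProduct.induction_on with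
  | zero => exact Commute.zero_right _
  | tmul h w =>
    have : (h ⊗ₜ w : LocalAlg U ι) = coeff h * (1 ⊗ₜ w) := by simp [coeff]
    rw [this]
    exact (coeff_commute h x).symm.mul_right (hj w)
  | add y z hy hz => exact hy.add_right hz

/-- The value on jet coordinates of the substitution `b^a ↦ β^a`. -/
def substVal (β : ι → evenPart U ι) : Jet ι → LocalAlg U ι
  | (FieldComp.aux a, I) => iterD totalD I (β a : LocalAlg U ι)
  | (FieldComp.gaugeField μ a, I) => 1 ⊗ₜ jet (FieldComp.gaugeField μ a, I)
  | (FieldComp.ghost a, I) => 1 ⊗ₜ jet (FieldComp.ghost a, I)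
  | (FieldComp.antighost a, I) => 1 ⊗ₜ jet (FieldComp.antighost a, I)

theorem substVal_mul (β : ι → evenPart U ι) (s t : Jet ι) :
    substVal β s * substVal β t =
      (-1 : ℝ) ^ (s.1.parity * t.1.parity) • (substVal β t * substVal β s) := by
  have hβ : ∀ a I, parityLoc (iterD totalD I (β a : LocalAlg U ι)) =
      iterD totalD I (β a : LocalAlg U ι) := fun a I => by
    rw [parityLoc_iterD, show parityLoc (β a : LocalAlg U ι) = β a from (β a).2]
  have hj : ∀ s t : Jet ι, (1 ⊗ₜ jet s : LocalAlg U ι) * (1 ⊗ₜ jet t) =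
      (-1 : ℝ) ^ (s.1.parity * t.1.parity) • ((1 ⊗ₜ jet t) * (1 ⊗ₜ jet s)) := fun s t => by
    rw [Algebra.TensorProduct.tmul_mul_tmul, jet_mul_jet, Algebra.TensorProduct.tmul_mul_tmul,
      TensorProduct.tmul_smul]
  obtain ⟨φ, I⟩ := s
  obtain ⟨ψ, K⟩ := t
  cases φ <;> cases ψ <;>
    first
    | exact hj _ _
    | (simp only [FieldComp.parity, mul_zero, zero_mul, pow_zero, one_smul, substVal]
       first
       | exact (even_commute (hβ _ _) _).eq
       | exact (even_commute (hβ _ _) _).eq.symm)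

/-- Substitution of even local expressions `β^a` for the auxiliary field: the homomorphism over
the smooth functions with `∂_I b^a ↦ ∂_I β^a` that fixes the jets of the other fields. -/
def substAux (β : ι → evenPart U ι) : LocalAlg U ι →ₐ[ℝ] LocalAlg U ι :=
  Algebra.TensorProduct.lift Algebra.TensorProduct.includeLeft
    (jetLift (substVal β) (substVal_mul β)) fun h x => by
      rw [Algebra.TensorProduct.includeLeft_apply]
      exact coeff_commute h (jetLift (substVal β) (substVal_mul β) x)

theorem substAux_tmul_jet (β : ι → evenPart U ι) (h : SmoothFun U) (u : Jet ι) :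
    substAux β (h ⊗ₜ jet u) = coeff h * substVal β u := by
  rw [substAux, Algebra.TensorProduct.lift_tmul, jetLift_jet,
    Algebra.TensorProduct.includeLeft_apply, coeff]

/-! ### The gauge fixing boson and the Lagrange densities -/

section Densities

variable [Fintype ι] (m : LorentzMetric U) (f : ι → ι → ι → ℝ) (gc ξ : ℝ)

/-- the gauge field `A^a_μ` -/
def A (U : TopologicalSpace.Opens Coord) (μ : Fin 4) (a : ι) : LocalAlg U ι :=
  field (.gaugeField μ a)

/-- the ghost `c^a` -/
def gh (U : TopologicalSpace.Opens Coord) (a : ι) : LocalAlg U ι := field (.ghost a)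

/-- the antighost `c̄^a` (colour indices are raised and lowered with `δ_{ab}`) -/
def agh (U : TopologicalSpace.Opens Coord) (a : ι) : LocalAlg U ι := field (.antighost a)

/-- the auxiliary field `b^a` -/
def auxB (U : TopologicalSpace.Opens Coord) (a : ι) : LocalAlg U ι := field (.aux a)

/-- The gauge fixing boson `G = -(ξ/2) (δ_{ab} g^{μν} A^a_μ A^b_ν - c̄_a c^a) dV_g`. -/
def gaugeFixingBoson : LocalAlg U ι :=
  coeff m.vol * (-(ξ / 2)) • ((∑ μ, ∑ ν, ∑ a, coeff (m.inv μ ν) * (A U μ a * A U ν a))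
    - ∑ a, agh U a * gh U a)

/-- The covariant Lorenz gauge fixing functional
`L^a = gc g^{μν} ∇_μ A^a_ν` with `∇_μ A_ν = ∂_μ A_ν - Γ^ρ_{μν} A_ρ`. -/
def lorenz (a : ι) : LocalAlg U ι :=
  gc • ∑ μ, ∑ ν, coeff (m.inv μ ν) *
    (totalD μ (A U ν a) - ∑ ρ, coeff (m.christoffel ρ μ ν) * A U ρ a)

/-- `f^a_{bc} f_{ade} c̄^b c̄^c c^d c^e`. -/
def fourGhost : LocalAlg U ι :=
  ∑ a, ∑ b, ∑ c, ∑ d, ∑ e, (f a b c * f a d e) • (agh U b * agh U c * gh U d * gh U e)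

/-- The density `𝒬 G` with the auxiliary field:
`( (1/2ξ) b_a b^a + (1/(gc ξ)) b_a L^a + (1/ξ) g^{μν} (∂_μ c̄_a)(∂_ν c^a)
+ gc g^{μν} f^a_{bc} (∂_μ c̄_a) c^b A^c_ν - (gc/2) f^a_{bc} b_a c̄^b c^c
- (gc² ξ/8) f^a_{bc} f_{ade} c̄^b c̄^c c^d c^e ) dV_g`. -/
def auxDensity : LocalAlg U ι :=
  coeff m.vol *
    ((1 / (2 * ξ)) • (∑ a, auxB U a * auxB U a)
      + (1 / (gc * ξ)) • (∑ a, auxB U a * lorenz m gc a)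
      + (1 / ξ) • (∑ μ, ∑ ν, ∑ a, coeff (m.inv μ ν) * (totalD μ (agh U a) * totalD ν (gh U a)))
      + gc • (∑ μ, ∑ ν, ∑ a, ∑ b, ∑ c,
          f a b c • (coeff (m.inv μ ν) * (totalD μ (agh U a) * gh U b * A U ν c)))
      - (gc / 2) • (∑ a, ∑ b, ∑ c, f a b c • (auxB U a * agh U b * gh U c))
      - (gc ^ 2 * ξ / 8) • fourGhost f)

/-- The symmetric gauge fixing and ghost density:
`(1/ξ) ( -(1/(2 gc²)) δ_{ab} L^a L^b + g^{μν} (∂_μ c̄_a)(∂_ν c^a) ) dV_g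
+ (gc/2) g^{μν} f^a_{bc} ( (∂_μ c̄_a) c^b A^c_ν - c̄_a (∂_μ c^b) A^c_ν ) dV_g
- (gc² ξ/16) f^a_{bc} f_{ade} c̄^b c̄^c c^d c^e dV_g`. -/
def symmetricDensity : LocalAlg U ι :=
  coeff m.vol *
    ((1 / ξ) • (-((1 / (2 * gc ^ 2)) • ∑ a, lorenz m gc a * lorenz m gc a)
        + ∑ μ, ∑ ν, ∑ a, coeff (m.inv μ ν) * (totalD μ (agh U a) * totalD ν (gh U a)))
      + (gc / 2) • (∑ μ, ∑ ν, ∑ a, ∑ b, ∑ c, f a b c • (coeff (m.inv μ ν) *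
          (totalD μ (agh U a) * gh U b * A U ν c - agh U a * totalD μ (gh U b) * A U ν c)))
      - (gc ^ 2 * ξ / 16) • fourGhost f)

/-- The shifted auxiliary field `b'^a = b^a - (gc ξ/2) f^a_{bc} c̄^b c^c`. -/
def shiftedAux (a : ι) : LocalAlg U ι :=
  auxB U a - (gc * ξ / 2) • bracket f (agh U) (gh U) a

theorem shift_even (a : ι) :
    auxB U a + (gc * ξ / 2) • bracket f (agh U) (gh U) a ∈ evenPart U ι := by
  have h1 : ∀ φ : FieldComp ι, parityLoc (field φ : LocalAlg U ι) =
      (-1 : ℝ) ^ φ.parity • field φ := fun φ => by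
    simp [parityLoc, field, parityHom_fld, TensorProduct.tmul_smul]
  change parityLoc _ = _
  rw [map_add, map_smul, map_bracket]
  simp only [auxB, agh, gh, h1, FieldComp.parity, pow_zero, one_smul, pow_one]
  rw [bracket_smul]
  simp
  rfl

/-- The change of variables from `b` to the shifted auxiliary field,
`b^a = b'^a + (gc ξ/2) f^a_{bc} c̄^b c^c`: in its values the generator `b^a` stands for `b'^a`. -/
def shift : LocalAlg U ι →ₐ[ℝ] LocalAlg U ι :=
  substAux fun a => ⟨auxB U a + (gc * ξ / 2) • bracket f (agh U) (gh U) a, shift_even f gc ξ a⟩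

end Densities

end LocalAlg

/-! ## The gauge Lie algebra -/

section Lie

variable {𝔤 : Type*} [LieRing 𝔤] [LieAlgebra ℝ 𝔤] {ι : Type*} (T : Module.Basis ι ℝ 𝔤)

/-- The structure constants `f^a_{bc}` of the basis `T`: `[T_b, T_c] = f^a_{bc} T_a`. -/
def structureConst (a b c : ι) : ℝ := T.repr ⁅T b, T c⁆ a

/-- The colour metric `δ_{ab}`, for which the basis `T` is orthonormal. -/
def colorMetric [Fintype ι] (x y : 𝔤) : ℝ := ∑ a, T.repr x a * T.repr y a

end Lie

end QYM

end

/-!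
The super-BRST variation of the gauge fixing boson is computed exactly by the Leibniz rule: total
antisymmetry of the structure constants removes the terms `f A A c̄`, and the auxiliary field enters
through `g^{μν} A^a_μ ∂_ν b_a`. The only total divergence is the one that integrates this term by
parts into `-b_a ∇^μ A^a_μ`; it is the divergence of `√(-det g) g^{μν} A^a_μ b_a`, because
`∂_ν (√(-det g) g^{νρ}) = -√(-det g) g^{μν} Γ^ρ_{μν}` for the Levi-Civita connection.

Write `[X, Y]^a = f^a_{bc} X^b Y^c`. Shifting `b` by `(gc ξ / 2) [c̄, c]` completes the square: it
removes the linear term `b_a [c̄, c]^a`, antisymmetrises the ghost vertex, and creates a term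
`[c̄, c]_a [c̄, c]^a`, which the Jacobi identity for odd fields turns into a multiple of
`[c̄, c̄]_a [c, c]^a`, halving the quartic coupling. The shifted density is quadratic in `b`, so its
Euler–Lagrange derivative is `(1 / ξ) √(-det g) (b^a + ∇^μ A^a_μ)`, and `√(-det g) / ξ` is
invertible.
-/

noncomputable section

namespace QYM

section Derivation

variable {R A n : Type*} [CommRing R] [CommRing A] [Algebra R A] (D : Derivation R A A)

theorem derivation_prod [DecidableEq n] (s : Finset n) (g : n → A) :
    D (∏ i ∈ s, g i) = ∑ i ∈ s, (∏ j ∈ s.erase i, g j) * D (g i) := by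
  induction s using Finset.induction_on with
  | empty => simp
  | insert a s ha ih =>
    rw [Finset.prod_insert ha, Derivation.leibniz, ih, Finset.sum_insert ha,
      Finset.erase_insert ha, smul_eq_mul, smul_eq_mul, Finset.mul_sum, add_comm]
    congr 1
    refine Finset.sum_congr rfl fun i hi => ?_
    have hai : a ≠ i := fun h => ha (h ▸ hi)
    rw [Finset.erase_insert_of_ne hai, Finset.prod_insert (by simp [ha]), mul_assoc]

variable [Fintype n]

theorem derivation_matrix_mul (M N : Matrix n n A) :
    (M * N).map D = M.map D * N + M * N.map D := by
  ext i j
  simp only [Matrix.map_apply, Matrix.mul_apply, Matrix.add_apply, map_sum, Derivation.leibniz,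
    smul_eq_mul, ← Finset.sum_add_distrib]
  exact Finset.sum_congr rfl fun k _ => by ring

variable [DecidableEq n]

theorem derivation_det (M : Matrix n n A) : D M.det = (M.adjugate * M.map D).trace := by
  have adjugate_mul_diag (i : n) :
      (M.adjugate * M.map D) i i = (M.updateCol i fun j => D (M j i)).det := by
    rw [← Matrix.cramer_apply, Matrix.cramer_eq_adjugate_mulVec]
    rfl
  simp only [Matrix.trace, Matrix.diag, adjugate_mul_diag, Matrix.det_apply, map_sum]
  rw [Finset.sum_comm]
  refine Finset.sum_congr rfl fun σ _ => ?_
  rw [Units.smul_def, map_zsmul, derivation_prod, Finset.smul_sum]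
  refine Finset.sum_congr rfl fun i _ => ?_
  rw [Units.smul_def, ← Finset.mul_prod_erase _ _ (Finset.mem_univ i), Matrix.updateCol_self,
    mul_comm]
  congr 2
  refine Finset.prod_congr rfl fun j hj => ?_
  rw [Matrix.updateCol_ne (Finset.ne_of_mem_erase hj)]

theorem derivation_matrix_inv {M : Matrix n n A} (hM : IsUnit M.det) :
    M⁻¹.map D = -(M⁻¹ * M.map D * M⁻¹) := by
  have map_one : (1 : Matrix n n A).map D = 0 := by
    ext i j
    by_cases h : i = j <;> simp [h]
  have leibniz := derivation_matrix_mul D M⁻¹ M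
  rw [Matrix.nonsing_inv_mul M hM, map_one] at leibniz
  calc M⁻¹.map D = M⁻¹.map D * M * M⁻¹ := (Matrix.mul_nonsing_inv_cancel_right M _ hM).symm
    _ = -(M⁻¹ * M.map D * M⁻¹) := by
      rw [eq_neg_of_add_eq_zero_left leibniz.symm, Matrix.neg_mul]

end Derivation

section SmoothFun

variable {U : TopologicalSpace.Opens Coord}

theorem partialDeriv_mul (μ : Fin 4) (a b : SmoothFun U) :
    partialDeriv μ (a * b) = partialDeriv μ a * b + a * partialDeriv μ b := by
  ext x
  have fderiv_mul : fderiv ℝ (extendZero (a * b).1) x =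
      fderiv ℝ (fun y => extendZero a.1 y * extendZero b.1 y) x :=
    fderiv_extendZero_congr (fun x => by simp [extendZero_apply]) x
  change fderiv ℝ (extendZero (a * b).1) x (Pi.single μ 1) =
    fderiv ℝ (extendZero a.1) x (Pi.single μ 1) * b.1 x +
      a.1 x * fderiv ℝ (extendZero b.1) x (Pi.single μ 1)
  rw [fderiv_mul, fderiv_fun_mul (SmoothFun.differentiableAt a x) (SmoothFun.differentiableAt b x)]
  simp only [extendZero_apply, add_apply, smul_apply, smul_eq_mul]
  ring

/-- The coordinate derivative `∂_μ` as a derivation of the algebra of smooth functions. -/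
def partialDerivation (μ : Fin 4) : Derivation ℝ (SmoothFun U) (SmoothFun U) :=
  Derivation.mk' (partialDeriv μ) fun a b => by
    rw [partialDeriv_mul, smul_eq_mul, smul_eq_mul]; ring

theorem partialDerivation_apply (μ : Fin 4) (a : SmoothFun U) :
    partialDerivation μ a = partialDeriv μ a := rfl

theorem SmoothFun.isUnit_of_ne_zero (h : SmoothFun U) (h0 : ∀ x : U, (h : U → ℝ) x ≠ 0) :
    IsUnit h := by
  have contDiffOn_inv : ContDiffOn ℝ ∞ (fun x => (extendZero h.1 x)⁻¹) U :=
    h.2.inv fun x hx => by rw [extendZero_apply h.1 ⟨x, hx⟩]; exact h0 _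
  refine IsUnit.of_mul_eq_one ⟨fun x => ((h : U → ℝ) x)⁻¹,
    contDiffOn_extendZero contDiffOn_inv fun x => by rw [extendZero_apply]⟩ ?_
  ext x
  exact mul_inv_cancel₀ (h0 x)

end SmoothFun

namespace LorentzMetric

variable {U : TopologicalSpace.Opens Coord} (m : LorentzMetric U)

theorem isUnit_det : IsUnit m.comp.det :=
  SmoothFun.isUnit_of_ne_zero _ fun x => (m.det_neg x).ne

theorem isUnit_vol : IsUnit m.vol :=
  SmoothFun.isUnit_of_ne_zero _ fun x =>
    (Real.sqrt_pos.mpr (neg_pos.mpr (m.det_neg x))).ne'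

theorem vol_mul_vol : m.vol * m.vol = -m.comp.det := by
  ext x
  exact Real.mul_self_sqrt (neg_pos.mpr (m.det_neg x)).le

theorem comp_symm (μ ν : Fin 4) : m.comp μ ν = m.comp ν μ :=
  m.symm.apply ν μ

theorem inv_symm (μ ν : Fin 4) : m.inv μ ν = m.inv ν μ := by
  have transpose_inv : (m.comp⁻¹).transpose = m.comp⁻¹ := by
    rw [Matrix.transpose_nonsing_inv, m.symm.eq]
  exact congrFun (congrFun transpose_inv ν) μ

theorem christoffel_symm (ρ μ ν : Fin 4) : m.christoffel ρ μ ν = m.christoffel ρ ν μ := by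
  simp only [christoffel, m.comp_symm μ ν, add_comm (partialDeriv μ _)]

theorem sum_comp_mul_christoffel (μ α β : Fin 4) :
    ∑ ρ, m.comp α ρ * m.christoffel ρ μ β =
      (1 / 2 : ℝ) • (partialDeriv μ (m.comp α β) + partialDeriv β (m.comp α μ)
        - partialDeriv α (m.comp μ β)) := by
  have lower (Y : Fin 4 → SmoothFun U) : m.comp.mulVec (m.comp⁻¹.mulVec Y) = Y := by
    rw [Matrix.mulVec_mulVec, Matrix.mul_nonsing_inv _ m.isUnit_det, Matrix.one_mulVec]
  simp only [christoffel, mul_smul_comm, ← Finset.smul_sum]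
  exact congrArg _ (congrFun (lower _) α)

/-- The matrix `(Γ_μ)^ρ_ν = Γ^ρ_{μν}` of the Levi-Civita connection along `∂_μ`. -/
def connectionMatrix (μ : Fin 4) : Matrix (Fin 4) (Fin 4) (SmoothFun U) :=
  Matrix.of fun ρ ν => m.christoffel ρ μ ν

/-- Metric compatibility `∇g = 0` in matrix form. -/
theorem map_partialDerivation_comp (μ : Fin 4) :
    m.comp.map (partialDerivation μ) =
      m.comp * m.connectionMatrix μ + (m.connectionMatrix μ).transpose * m.comp := by
  ext1 α β
  have transpose_entry : ((m.connectionMatrix μ).transpose * m.comp) α β =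
      ∑ ρ, m.comp β ρ * m.christoffel ρ μ α := by
    simp only [Matrix.mul_apply, Matrix.transpose_apply, connectionMatrix, Matrix.of_apply,
      m.comp_symm β]
    exact Finset.sum_congr rfl fun ρ _ => mul_comm _ _
  rw [Matrix.add_apply, transpose_entry, sum_comp_mul_christoffel]
  simp only [Matrix.mul_apply, connectionMatrix, Matrix.of_apply, sum_comp_mul_christoffel,
    Matrix.map_apply, partialDerivation_apply, m.comp_symm β, m.comp_symm α μ]
  module

theorem map_partialDerivation_inv (μ : Fin 4) :
    m.comp⁻¹.map (partialDerivation μ) =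
      -(m.connectionMatrix μ * m.comp⁻¹ + m.comp⁻¹ * (m.connectionMatrix μ).transpose) := by
  rw [derivation_matrix_inv _ m.isUnit_det, map_partialDerivation_comp, Matrix.mul_add,
    ← Matrix.mul_assoc, Matrix.nonsing_inv_mul _ m.isUnit_det, Matrix.one_mul, Matrix.add_mul,
    ← Matrix.mul_assoc, Matrix.mul_nonsing_inv_cancel_right _ _ m.isUnit_det]

theorem partialDeriv_vol (μ : Fin 4) :
    partialDeriv μ m.vol = m.vol * (m.connectionMatrix μ).trace := by
  have adjugate_eq : m.comp.adjugate = m.comp.det • m.comp⁻¹ := by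
    rw [Matrix.inv_def, smul_smul, Ring.mul_inverse_cancel _ m.isUnit_det, one_smul]
  have trace_eq : (m.comp⁻¹ * m.comp.map (partialDerivation μ)).trace =
      (m.connectionMatrix μ).trace + (m.connectionMatrix μ).trace := by
    rw [map_partialDerivation_comp, Matrix.mul_add, Matrix.trace_add, ← Matrix.mul_assoc,
      Matrix.nonsing_inv_mul _ m.isUnit_det, Matrix.one_mul, Matrix.trace_mul_comm,
      Matrix.mul_nonsing_inv_cancel_right _ _ m.isUnit_det, Matrix.trace_transpose]
  have leibniz := congrArg (partialDerivation μ) m.vol_mul_vol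
  rw [map_neg, derivation_det, adjugate_eq, Matrix.smul_mul, Matrix.trace_smul, trace_eq,
    Derivation.leibniz, smul_eq_mul, smul_eq_mul, partialDerivation_apply] at leibniz
  refine m.isUnit_vol.mul_left_cancel (smul_right_injective _ (two_ne_zero' ℝ) ?_)
  simp only [two_smul]
  linear_combination leibniz - 2 * (m.connectionMatrix μ).trace * m.vol_mul_vol

theorem sum_partialDeriv_vol_mul_inv (ρ : Fin 4) :
    ∑ μ, partialDeriv μ (m.vol * m.inv μ ρ) =
      -(m.vol * ∑ μ, ∑ ν, m.inv μ ν * m.christoffel ρ μ ν) := by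
  have partialDeriv_inv (μ : Fin 4) : partialDeriv μ (m.inv μ ρ) =
      -(∑ σ, m.christoffel μ μ σ * m.inv σ ρ + ∑ ν, m.inv μ ν * m.christoffel ρ μ ν) :=
    congrFun (congrFun (m.map_partialDerivation_inv μ) μ) ρ
  have trace_contract : ∑ μ, (m.connectionMatrix μ).trace * m.inv μ ρ =
      ∑ μ, ∑ σ, m.christoffel μ μ σ * m.inv σ ρ := by
    simp only [Matrix.trace, Matrix.diag, connectionMatrix, Matrix.of_apply, Finset.sum_mul]
    rw [Finset.sum_comm]
    simp only [m.christoffel_symm]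
  calc ∑ μ, partialDeriv μ (m.vol * m.inv μ ρ)
      = m.vol * (∑ μ, (m.connectionMatrix μ).trace * m.inv μ ρ
          - ∑ μ, ∑ σ, m.christoffel μ μ σ * m.inv σ ρ
          - ∑ μ, ∑ ν, m.inv μ ν * m.christoffel ρ μ ν) := by
        rw [← Finset.sum_sub_distrib, ← Finset.sum_sub_distrib, Finset.mul_sum]
        refine Finset.sum_congr rfl fun μ _ => ?_
        rw [partialDeriv_mul, partialDeriv_vol, partialDeriv_inv]
        ring
    _ = -(m.vol * ∑ μ, ∑ ν, m.inv μ ν * m.christoffel ρ μ ν) := by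
        rw [trace_contract]
        ring

end LorentzMetric

section Bracket

variable {ι B : Type*} [Fintype ι] [Ring B] [Algebra ℝ B] {f : ι → ι → ι → ℝ}

theorem bracket_smul_left (r : ℝ) (X Y : ι → B) : bracket f (r • X) Y = r • bracket f X Y := by
  funext a
  simp only [bracket, Pi.smul_apply, smul_mul_assoc, Finset.smul_sum, smul_comm r]

theorem bracket_smul_right (r : ℝ) (X Y : ι → B) : bracket f X (r • Y) = r • bracket f X Y := by
  funext a
  simp only [bracket, Pi.smul_apply, mul_smul_comm, Finset.smul_sum, smul_comm r]

theorem dotProduct_comm_of_smul {s : ℝ} {X Y : ι → B}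
    (hXY : ∀ a, X a * Y a = s • (Y a * X a)) : X ⬝ᵥ Y = s • (Y ⬝ᵥ X) := by
  simp only [dotProduct, Finset.smul_sum, hXY]

theorem bracket_comm_of_smul (hanti : ∀ a b c, f a c b = -f a b c) {s : ℝ} {X Y : ι → B}
    (hXY : ∀ a b, X a * Y b = s • (Y b * X a)) : bracket f X Y = -(s • bracket f Y X) := by
  funext a
  simp only [bracket, Pi.neg_apply, Pi.smul_apply, Finset.smul_sum, ← Finset.sum_neg_distrib]
  rw [Finset.sum_comm]
  refine Finset.sum_congr rfl fun c _ => Finset.sum_congr rfl fun b _ => ?_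
  rw [hXY, hanti, neg_smul, smul_comm]

theorem bracket_dotProduct (hcyc : ∀ a b c, f a b c = f b c a) (X Y Z : ι → B) :
    bracket f X Y ⬝ᵥ Z = X ⬝ᵥ bracket f Y Z := by
  simp only [dotProduct, bracket, Finset.sum_mul, Finset.mul_sum, smul_mul_assoc, mul_smul_comm,
    mul_assoc]
  rw [Finset.sum_comm]
  refine Finset.sum_congr rfl fun b _ => ?_
  rw [Finset.sum_comm]
  simp only [hcyc _ b]

theorem dotProduct_bracket_eq_sum (X Y Z : ι → B) :
    X ⬝ᵥ bracket f Y Z = ∑ a, ∑ b, ∑ c, f a b c • (X a * Y b * Z c) := by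
  simp only [dotProduct, bracket, Finset.mul_sum, mul_smul_comm, mul_assoc]

theorem bracket_bracket_apply (X Y Z : ι → B) (e : ι) :
    bracket f X (bracket f Y Z) e =
      ∑ b, ∑ c, ∑ d, (∑ a, f e b a * f a c d) • (X b * Y c * Z d) := by
  simp only [bracket, Finset.mul_sum, Finset.smul_sum, mul_smul_comm, smul_smul, Finset.sum_smul,
    mul_assoc]
  refine Finset.sum_congr rfl fun b _ => ?_
  rw [Finset.sum_comm]
  refine Finset.sum_congr rfl fun c _ => ?_
  rw [Finset.sum_comm]

theorem bracket_jacobi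
    (hjac : ∀ e b c d, ∑ a, (f e b a * f a c d + f e c a * f a d b + f e d a * f a b c) = 0)
    {X Y Z : ι → B} (hYZX : ∀ b c d, Y c * Z d * X b = X b * Y c * Z d)
    (hZXY : ∀ b c d, Z d * X b * Y c = X b * Y c * Z d) :
    bracket f X (bracket f Y Z) + bracket f Y (bracket f Z X) +
      bracket f Z (bracket f X Y) = 0 := by
  funext e
  have rotate_YZX : bracket f Y (bracket f Z X) e =
      ∑ b, ∑ c, ∑ d, (∑ a, f e c a * f a d b) • (X b * Y c * Z d) := by
    simp only [bracket_bracket_apply, hYZX]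
    exact (Finset.sum_congr rfl fun c _ => Finset.sum_comm).trans Finset.sum_comm
  have rotate_ZXY : bracket f Z (bracket f X Y) e =
      ∑ b, ∑ c, ∑ d, (∑ a, f e d a * f a b c) • (X b * Y c * Z d) := by
    simp only [bracket_bracket_apply, hZXY]
    exact Finset.sum_comm.trans (Finset.sum_congr rfl fun b _ => Finset.sum_comm)
  simp only [Pi.add_apply, Pi.zero_apply, rotate_YZX, rotate_ZXY, bracket_bracket_apply,
    ← Finset.sum_add_distrib, ← add_smul, hjac, zero_smul, Finset.sum_const_zero]

/-- For odd elements the Jacobi identity reads `2 [Y, [X, Y]] = -[X, [Y, Y]]`. -/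
theorem bracket_dotProduct_bracket_of_odd
    (hcyc : ∀ a b c, f a b c = f b c a) (hanti : ∀ a b c, f a c b = -f a b c)
    (hjac : ∀ e b c d, ∑ a, (f e b a * f a c d + f e c a * f a d b + f e d a * f a b c) = 0)
    {X Y : ι → B} (hXY : ∀ a b, X a * Y b = -(Y b * X a)) (hYY : ∀ a b, Y a * Y b = -(Y b * Y a)) :
    bracket f X Y ⬝ᵥ bracket f X Y = -((1 / 2 : ℝ) • (bracket f X X ⬝ᵥ bracket f Y Y)) := by
  have bracket_comm : bracket f Y X = bracket f X Y := by
    rw [bracket_comm_of_smul (s := -1) hanti fun a b => by rw [hXY b a, neg_one_smul, neg_neg],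
      neg_one_smul, neg_neg]
  have cycle (b c d : ι) : Y c * Y d * X b = X b * Y c * Y d := by
    rw [hXY, neg_mul, mul_assoc (Y c) (X b), hXY, mul_neg, neg_neg, mul_assoc]
  have jacobi : bracket f X (bracket f Y Y) + bracket f Y (bracket f Y X)
      + bracket f Y (bracket f X Y) = 0 := by
    refine bracket_jacobi hjac cycle fun b c d => ?_
    rw [← cycle b c d, mul_assoc, hXY, mul_neg, ← mul_assoc, hYY d c, neg_mul, neg_neg]
  have bracket_bracket : bracket f Y (bracket f X Y) =
      -((1 / 2 : ℝ) • bracket f X (bracket f Y Y)) := by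
    rw [bracket_comm, add_assoc] at jacobi
    rw [eq_neg_of_add_eq_zero_left jacobi]
    module
  rw [bracket_dotProduct hcyc, bracket_bracket, dotProduct_neg, dotProduct_smul,
    bracket_dotProduct hcyc]

end Bracket

section Leibniz

variable {ι B : Type*} [Fintype ι] [Ring B] [Algebra ℝ B] {D : B →ₗ[ℝ] B} {s : ℝ} {X Y : ι → B}

theorem map_dotProduct_of_leibniz
    (h : ∀ a, D (X a * Y a) = D (X a) * Y a + s • (X a * D (Y a))) :
    D (X ⬝ᵥ Y) = (D ∘ X) ⬝ᵥ Y + s • (X ⬝ᵥ (D ∘ Y)) := by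
  simp only [dotProduct, map_sum, h, Finset.sum_add_distrib, Finset.smul_sum, Function.comp_apply]

theorem map_bracket_of_leibniz (f : ι → ι → ι → ℝ)
    (h : ∀ a b, D (X a * Y b) = D (X a) * Y b + s • (X a * D (Y b))) :
    D ∘ bracket f X Y = bracket f (D ∘ X) Y + s • bracket f X (D ∘ Y) := by
  funext a
  simp only [bracket, Function.comp_apply, map_sum, map_smul, h, Finset.sum_add_distrib,
    smul_add, Finset.smul_sum, Pi.add_apply, Pi.smul_apply, smul_comm s]

end Leibniz

section Lie

variable {𝔤 : Type*} [LieRing 𝔤] [LieAlgebra ℝ 𝔤] {ι : Type*} (T : Module.Basis ι ℝ 𝔤)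

theorem structureConst_swap (a b c : ι) :
    structureConst T a c b = -structureConst T a b c := by
  rw [structureConst, ← lie_skew, map_neg]
  rfl

variable [Fintype ι]

theorem structureConst_jacobi (e b c d : ι) :
    ∑ a, (structureConst T e b a * structureConst T a c d
      + structureConst T e c a * structureConst T a d b
      + structureConst T e d a * structureConst T a b c) = 0 := by
  have repr_lie_lie (x y z : ι) : T.repr ⁅T x, ⁅T y, T z⁆⁆ e =
      ∑ a, structureConst T e x a * structureConst T a y z := by
    conv_lhs => rw [← T.sum_repr ⁅T y, T z⁆]
    simp only [lie_sum, lie_smul, map_sum, map_smul, Finsupp.coe_finsetSum, Finset.sum_apply,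
      Finsupp.smul_apply, smul_eq_mul]
    exact Finset.sum_congr rfl fun a _ => mul_comm _ _
  have jacobi := congrArg (fun v => T.repr v e) (lie_jacobi (T b) (T c) (T d))
  simpa only [map_add, Finsupp.add_apply, repr_lie_lie, map_zero, Finsupp.zero_apply,
    Finset.sum_add_distrib] using jacobi

theorem colorMetric_basis (x : 𝔤) (a : ι) : colorMetric T x (T a) = T.repr x a := by
  classical
  simp [colorMetric, Finsupp.single_apply]

theorem colorMetric_comm (x y : 𝔤) : colorMetric T x y = colorMetric T y x :=
  Finset.sum_congr rfl fun _ _ => mul_comm _ _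

theorem structureConst_cyclic
    (hT : ∀ x y z : 𝔤, colorMetric T ⁅x, y⁆ z = -colorMetric T y ⁅x, z⁆) (a b c : ι) :
    structureConst T a b c = structureConst T b c a := by
  have invariance := hT (T c) (T a) (T b)
  rw [colorMetric_basis, colorMetric_comm, colorMetric_basis] at invariance
  change structureConst T b c a = -structureConst T a c b at invariance
  rw [invariance, structureConst_swap T a c b]

end Lie

section LocalAlg

variable {U : TopologicalSpace.Opens Coord} {ι : Type*}

theorem coeff_mul (h k : SmoothFun U) : (coeff (h * k) : LocalAlg U ι) = coeff h * coeff k := by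
  simp [coeff]

theorem coeff_neg (h : SmoothFun U) : (coeff (-h) : LocalAlg U ι) = -coeff h :=
  TensorProduct.neg_tmul _ _

theorem coeff_sum {α : Type*} (s : Finset α) (h : α → SmoothFun U) :
    (coeff (∑ i ∈ s, h i) : LocalAlg U ι) = ∑ i ∈ s, coeff (h i) :=
  TensorProduct.sum_tmul _ _ _

theorem isUnit_coeff {h : SmoothFun U} (hh : IsUnit h) : IsUnit (coeff h : LocalAlg U ι) :=
  hh.map (Algebra.TensorProduct.includeLeft : SmoothFun U →ₐ[ℝ] LocalAlg U ι)

theorem localAlg_induction {P : LocalAlg U ι → Prop} (coeff : ∀ h, P (coeff h))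
    (jet : ∀ u, P (1 ⊗ₜ jet u)) (mul : ∀ x y, P x → P y → P (x * y))
    (add : ∀ x y, P x → P y → P (x + y)) (x : LocalAlg U ι) : P x := by
  have one_tmul (w : JetAlg ι) : P (1 ⊗ₜ w) := by
    induction w using jet_induction with
    | hc r => simpa [QYM.coeff, TensorProduct.tmul_smul, Algebra.algebraMap_eq_smul_one,
        TensorProduct.smul_tmul'] using coeff (r • 1)
    | hj u => exact jet u
    | hm x y hx hy => simpa using mul _ _ hx hy
    | ha x y hx hy => simpa [TensorProduct.tmul_add] using add _ _ hx hy
  induction x using TensorProduct.induction_on with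
  | zero => simpa [QYM.coeff] using coeff 0
  | tmul h w => simpa [QYM.coeff] using mul _ _ (coeff h) (one_tmul w)
  | add x y hx hy => exact add _ _ hx hy

theorem leibniz_of_tmul {D σ : LocalAlg U ι →ₗ[ℝ] LocalAlg U ι}
    (h : ∀ (a b : SmoothFun U) (v w : JetAlg ι), D ((a ⊗ₜ v) * (b ⊗ₜ w)) =
      D (a ⊗ₜ v) * (b ⊗ₜ w) + σ (a ⊗ₜ v) * D (b ⊗ₜ w)) (x y : LocalAlg U ι) :
    D (x * y) = D x * y + σ x * D y := by
  induction x using TensorProduct.induction_on with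
  | zero => simp
  | add x z hx hz => simp only [add_mul, map_add, hx, hz]; abel
  | tmul a v =>
    induction y using TensorProduct.induction_on with
    | zero => simp
    | add y z hy hz => simp only [mul_add, map_add, hy, hz]; abel
    | tmul b w => exact h a b v w

/-! ### Total derivatives -/

theorem totalD_mul (μ : Fin 4) (x y : LocalAlg U ι) :
    totalD μ (x * y) = totalD μ x * y + x * totalD μ y := by
  refine leibniz_of_tmul (σ := LinearMap.id) (fun a b v w => ?_) x y
  have jetD_mul : jetD μ (v * w) = jetD μ v * w + v * jetD μ w := superDer_mul 0 _ _ v w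
  simp only [totalD, LinearMap.add_apply, LinearMap.rTensor_tmul, LinearMap.lTensor_tmul,
    Algebra.TensorProduct.tmul_mul_tmul, partialDeriv_mul, jetD_mul, TensorProduct.add_tmul,
    TensorProduct.tmul_add, LinearMap.id_apply, add_mul, mul_add]
  abel

theorem totalD_coeff (μ : Fin 4) (h : SmoothFun U) :
    totalD μ (coeff h : LocalAlg U ι) = coeff (partialDeriv μ h) := by
  have jetD_one : jetD μ (1 : JetAlg ι) = 0 := by
    rw [← map_one (algebraMap ℝ (JetAlg ι))]
    exact superDer_algebraMap 0 _ _ 1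
  simp [totalD, coeff, jetD_one]

theorem totalD_one_tmul (μ : Fin 4) (x : JetAlg ι) :
    totalD μ (1 ⊗ₜ x : LocalAlg U ι) = 1 ⊗ₜ jetD μ x := by
  have partialDeriv_one : partialDeriv μ (1 : SmoothFun U) = 0 :=
    (partialDerivation μ).map_one_eq_zero
  simp [totalD, partialDeriv_one]

theorem jetD_fld (μ : Fin 4) (φ : FieldComp ι) : jetD μ (fld φ) = jet (φ, Pi.single μ 1) := by
  rw [jetD, fld, superDer_jet, zero_add]

theorem totalD_field (μ : Fin 4) (φ : FieldComp ι) :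
    totalD μ (field φ : LocalAlg U ι) = 1 ⊗ₜ jet (φ, Pi.single μ 1) := by
  rw [field, totalD_one_tmul, jetD_fld]

theorem iterD_zero {M : Type*} [AddCommMonoid M] [Module ℝ M] (D : Fin 4 → Module.End ℝ M) :
    iterD D 0 = 1 := by
  simp [iterD]

theorem iterD_single {M : Type*} [AddCommMonoid M] [Module ℝ M] (D : Fin 4 → Module.End ℝ M)
    (μ : Fin 4) : iterD D (Pi.single μ 1) = D μ := by
  simp only [iterD, List.ofFn_succ, List.ofFn_zero, List.prod_cons, List.prod_nil, mul_one]
  fin_cases μ <;> simp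

theorem totalD_dotProduct [Fintype ι] (μ : Fin 4) (X Y : ι → LocalAlg U ι) :
    totalD μ (X ⬝ᵥ Y) = (totalD μ ∘ X) ⬝ᵥ Y + X ⬝ᵥ (totalD μ ∘ Y) := by
  simpa only [one_smul] using map_dotProduct_of_leibniz (D := totalD μ) (s := 1) (X := X) (Y := Y)
    fun a => by rw [totalD_mul, one_smul]

theorem totalD_bracket [Fintype ι] (f : ι → ι → ι → ℝ) (μ : Fin 4) (X Y : ι → LocalAlg U ι) :
    totalD μ ∘ bracket f X Y = bracket f (totalD μ ∘ X) Y + bracket f X (totalD μ ∘ Y) := by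
  simpa only [one_smul] using map_bracket_of_leibniz (D := totalD μ) (s := 1) (X := X) (Y := Y) f
    fun a b => by rw [totalD_mul, one_smul]

/-! ### Parity and supercommutation -/

theorem parityLoc_pow_tmul (p : ℕ) (h : SmoothFun U) (w : JetAlg ι) :
    (parityLoc ^ p) (h ⊗ₜ[ℝ] w) = h ⊗ₜ (parityHom ^ p) w := by
  induction p with
  | zero => simp
  | succ n ih => rw [pow_succ', AlgHom.mul_apply, ih, pow_succ', AlgHom.mul_apply]; rfl

theorem parityLoc_pow_coeff (p : ℕ) (h : SmoothFun U) :
    (parityLoc ^ p) (coeff h : LocalAlg U ι) = coeff h := by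
  rw [coeff, parityLoc_pow_tmul, map_one]

theorem parityLoc_field (φ : FieldComp ι) :
    parityLoc (field φ : LocalAlg U ι) = (-1 : ℝ) ^ φ.parity • field φ := by
  simp [parityLoc, field, parityHom_fld, TensorProduct.tmul_smul]

/-- Homogeneous local expressions: `x` has the parity of `k`. -/
def HasParity (k : ℕ) (x : LocalAlg U ι) : Prop :=
  parityLoc x = (-1 : ℝ) ^ k • x

theorem hasParity_A (μ : Fin 4) (a : ι) : HasParity 0 (A U μ a) := parityLoc_field _

theorem hasParity_gh (a : ι) : HasParity 1 (gh U a) := parityLoc_field _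

theorem hasParity_agh (a : ι) : HasParity 1 (agh U a) := parityLoc_field _

theorem hasParity_auxB (a : ι) : HasParity 0 (auxB U a) := parityLoc_field _

namespace HasParity

variable {k l : ℕ} {x y : LocalAlg U ι}

theorem totalD (hx : HasParity k x) (μ : Fin 4) : HasParity k (totalD μ x) := by
  calc parityLoc (QYM.totalD μ x) = QYM.totalD μ (parityLoc x) :=
        LinearMap.congr_fun (parityLoc_totalD μ) x
    _ = (-1 : ℝ) ^ k • QYM.totalD μ x := by rw [hx, map_smul]

theorem mem_evenPart (hx : HasParity k x) (hk : Even k) : x ∈ evenPart U ι := by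
  calc parityLoc x = (-1 : ℝ) ^ k • x := hx
    _ = x := by rw [hk.neg_one_pow, one_smul]

theorem parityLoc_pow_apply (hx : HasParity k x) (p : ℕ) :
    (parityLoc ^ p) x = (-1 : ℝ) ^ (p * k) • x := by
  induction p with
  | zero => simp
  | succ n ih =>
    rw [pow_succ', AlgHom.mul_apply, ih, map_smul, hx, smul_smul, ← pow_add, Nat.succ_mul]

theorem mul_eq (hx : HasParity k x) (y : LocalAlg U ι) : x * y = (parityLoc ^ k) y * x := by
  have jet_mul (u : Jet ι) (z : LocalAlg U ι) :
      (1 ⊗ₜ jet u) * z = (parityLoc ^ u.1.parity) z * (1 ⊗ₜ jet u) := by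
    induction z using TensorProduct.induction_on with
    | zero => simp
    | tmul h w => simp [parityLoc_pow_tmul, QYM.jet_mul u w]
    | add y z hy hz => rw [mul_add, hy, hz, map_add, add_mul]
  induction y using localAlg_induction with
  | coeff h => rw [parityLoc_pow_coeff, (coeff_commute h x).eq]
  | jet u =>
    rw [parityLoc_pow_tmul, parityHom_pow_jet, TensorProduct.tmul_smul, smul_mul_assoc, jet_mul,
      hx.parityLoc_pow_apply, smul_mul_assoc, smul_smul, mul_comm k, ← pow_add, ← two_mul, pow_mul,
      neg_one_sq, one_pow, one_smul]
  | mul y z hy hz => rw [← mul_assoc, hy, mul_assoc, hz, map_mul, mul_assoc]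
  | add y z hy hz => rw [mul_add, hy, hz, map_add, add_mul]

theorem mul_comm_smul (hx : HasParity k x) (hy : HasParity l y) :
    x * y = (-1 : ℝ) ^ (k * l) • (y * x) := by
  rw [hx.mul_eq, hy.parityLoc_pow_apply, smul_mul_assoc]

variable {X Y : ι → LocalAlg U ι}

theorem totalD_comp (hX : ∀ a, HasParity k (X a)) (μ : Fin 4) (a : ι) :
    HasParity k ((QYM.totalD μ ∘ X) a) :=
  (hX a).totalD μ

variable [Fintype ι] {f : ι → ι → ι → ℝ}

theorem bracket (hX : ∀ a, HasParity k (X a)) (hY : ∀ a, HasParity l (Y a)) (a : ι) :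
    HasParity (k + l) (bracket f X Y a) := by
  have parityLoc_X : (fun b => parityLoc (X b)) = (-1 : ℝ) ^ k • X := funext hX
  have parityLoc_Y : (fun b => parityLoc (Y b)) = (-1 : ℝ) ^ l • Y := funext hY
  rw [HasParity, map_bracket, parityLoc_X, parityLoc_Y, bracket_smul_left, bracket_smul_right,
    smul_smul, pow_add, Pi.smul_apply]

theorem dotProduct_comm_of_even (hX : ∀ a, HasParity k (X a)) (hk : Even k)
    (Y : ι → LocalAlg U ι) : X ⬝ᵥ Y = Y ⬝ᵥ X :=
  Finset.sum_congr rfl fun a _ => (even_commute ((hX a).mem_evenPart hk) (Y a)).eq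

theorem dotProduct_comm (hX : ∀ a, HasParity k (X a)) (hY : ∀ a, HasParity l (Y a)) :
    X ⬝ᵥ Y = (-1 : ℝ) ^ (k * l) • (Y ⬝ᵥ X) :=
  dotProduct_comm_of_smul fun a => (hX a).mul_comm_smul (hY a)

theorem bracket_comm (hanti : ∀ a b c, f a c b = -f a b c)
    (hX : ∀ a, HasParity k (X a)) (hY : ∀ a, HasParity l (Y a)) :
    QYM.bracket f X Y = -((-1 : ℝ) ^ (k * l) • QYM.bracket f Y X) :=
  bracket_comm_of_smul hanti fun a b => (hX a).mul_comm_smul (hY b)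

end HasParity

/-! ### Superderivations over the smooth functions -/

/-- A left superderivation of parity `p` of the local expressions that annihilates the coefficient
functions. Examples are the BRST and anti-BRST operators (odd) and the partial derivatives with
respect to jets of the auxiliary field (even); the total derivatives are not of this kind. -/
structure IsVerticalDer (p : ℕ) (D : LocalAlg U ι →ₗ[ℝ] LocalAlg U ι) : Prop where
  map_mul (x y : LocalAlg U ι) : D (x * y) = D x * y + (parityLoc ^ p) x * D y
  map_coeff (h : SmoothFun U) : D (coeff h) = 0

theorem isVerticalDer_superDer (p : ℕ) (v : Jet ι → JetAlg ι)
    (hv : ∀ u, parityHom (v u) = (-1 : ℝ) ^ (p + u.1.parity) • v u) :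
    IsVerticalDer p ((superDer p v hv).lTensor (SmoothFun U)) where
  map_mul := leibniz_of_tmul (σ := (parityLoc ^ p).toLinearMap) fun a b x y => by
    simp only [Algebra.TensorProduct.tmul_mul_tmul, LinearMap.lTensor_tmul, superDer_mul,
      AlgHom.toLinearMap_apply, parityLoc_pow_tmul, TensorProduct.tmul_add]
  map_coeff h := by
    have superDer_one : superDer p v hv 1 = 0 := by
      simpa only [map_one] using superDer_algebraMap p v hv 1
    rw [coeff, LinearMap.lTensor_tmul, superDer_one, TensorProduct.tmul_zero]

namespace IsVerticalDer

variable {p k : ℕ} {D : LocalAlg U ι →ₗ[ℝ] LocalAlg U ι}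

theorem map_coeff_mul (hD : IsVerticalDer p D) (h : SmoothFun U) (x : LocalAlg U ι) :
    D (coeff h * x) = coeff h * D x := by
  rw [hD.map_mul, hD.map_coeff, zero_mul, zero_add, parityLoc_pow_coeff]

theorem map_mul_of_hasParity (hD : IsVerticalDer p D) {x : LocalAlg U ι} (hx : HasParity k x)
    (y : LocalAlg U ι) : D (x * y) = D x * y + (-1 : ℝ) ^ (p * k) • (x * D y) := by
  rw [hD.map_mul, hx.parityLoc_pow_apply, smul_mul_assoc]

variable [Fintype ι] {X : ι → LocalAlg U ι}

theorem map_dotProduct (hD : IsVerticalDer p D) (hX : ∀ a, HasParity k (X a))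
    (Y : ι → LocalAlg U ι) :
    D (X ⬝ᵥ Y) = (D ∘ X) ⬝ᵥ Y + (-1 : ℝ) ^ (p * k) • (X ⬝ᵥ (D ∘ Y)) :=
  map_dotProduct_of_leibniz fun a => hD.map_mul_of_hasParity (hX a) (Y a)

theorem map_bracket (hD : IsVerticalDer p D) (hX : ∀ a, HasParity k (X a)) (f : ι → ι → ι → ℝ)
    (Y : ι → LocalAlg U ι) :
    D ∘ bracket f X Y =
      bracket f (D ∘ X) Y + (-1 : ℝ) ^ (p * k) • bracket f X (D ∘ Y) :=
  map_bracket_of_leibniz f fun a b => hD.map_mul_of_hasParity (hX a) (Y b)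

end IsVerticalDer

theorem evolutionary_lTensor_field (p : ℕ) (q : FieldComp ι → JetAlg ι)
    (hq : ∀ φ, parityHom (q φ) = (-1 : ℝ) ^ (p + φ.parity) • q φ) (φ : FieldComp ι) :
    (evolutionary p q hq).lTensor (SmoothFun U) (field φ) = 1 ⊗ₜ q φ := by
  rw [field, LinearMap.lTensor_tmul, evolutionary, fld, superDer_jet, iterD_zero]
  rfl

theorem evolutionary_lTensor_totalD_field (p : ℕ) (q : FieldComp ι → JetAlg ι)
    (hq : ∀ φ, parityHom (q φ) = (-1 : ℝ) ^ (p + φ.parity) • q φ) (μ : Fin 4)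
    (φ : FieldComp ι) :
    (evolutionary p q hq).lTensor (SmoothFun U) (totalD μ (field φ)) =
      totalD μ (1 ⊗ₜ q φ) := by
  rw [totalD_field, LinearMap.lTensor_tmul, evolutionary, superDer_jet, iterD_single,
    totalD_one_tmul]

theorem one_tmul_bracket_fld [Fintype ι] (f : ι → ι → ι → ℝ) (X Y : ι → FieldComp ι) (a : ι) :
    (1 ⊗ₜ bracket f (fun b => fld (X b)) (fun b => fld (Y b)) a : LocalAlg U ι) =
      bracket f (fun b => field (X b)) (fun b => field (Y b)) a :=
  map_bracket f (Algebra.TensorProduct.includeRight : JetAlg ι →ₐ[ℝ] LocalAlg U ι) _ _ a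

section Brst

variable [Fintype ι] (f : ι → ι → ι → ℝ) (gc ξ : ℝ)

theorem isVerticalDer_brst : IsVerticalDer 1 (brst (U := U) f gc ξ) :=
  isVerticalDer_superDer _ _ _

theorem isVerticalDer_antiBrst : IsVerticalDer 1 (antiBrst (U := U) f gc ξ) :=
  isVerticalDer_superDer _ _ _

theorem brst_comp_A (μ : Fin 4) :
    brst f gc ξ ∘ A U μ = (1 / ξ) • (totalD μ ∘ gh U) + gc • bracket f (gh U) (A U μ) := by
  funext a
  rw [Function.comp_apply, brst, A, evolutionary_lTensor_field, brstChar, TensorProduct.tmul_add,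
    TensorProduct.tmul_smul, TensorProduct.tmul_smul, one_tmul_bracket_fld, ← totalD_one_tmul]
  rfl

theorem brst_comp_gh : brst f gc ξ ∘ gh U = (gc / 2) • bracket f (gh U) (gh U) := by
  funext a
  rw [Function.comp_apply, brst, gh, evolutionary_lTensor_field, brstChar,
    TensorProduct.tmul_smul, one_tmul_bracket_fld]
  rfl

theorem brst_comp_agh : brst f gc ξ ∘ agh U = (1 / ξ) • auxB U := by
  funext a
  rw [Function.comp_apply, brst, agh, evolutionary_lTensor_field, brstChar,
    TensorProduct.tmul_smul]
  rfl

theorem brst_comp_auxB : brst f gc ξ ∘ auxB U = 0 := by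
  funext a
  rw [Function.comp_apply, brst, auxB, evolutionary_lTensor_field, brstChar,
    TensorProduct.tmul_zero]
  rfl

theorem brst_comp_totalD_agh (μ : Fin 4) :
    brst f gc ξ ∘ totalD μ ∘ agh U = (1 / ξ) • (totalD μ ∘ auxB U) := by
  funext a
  rw [Function.comp_apply, Function.comp_apply, brst, agh, evolutionary_lTensor_totalD_field,
    brstChar, TensorProduct.tmul_smul, map_smul]
  rfl

theorem antiBrst_comp_A (μ : Fin 4) :
    antiBrst f gc ξ ∘ A U μ = (1 / ξ) • (totalD μ ∘ agh U) + gc • bracket f (agh U) (A U μ) := by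
  funext a
  rw [Function.comp_apply, antiBrst, A, evolutionary_lTensor_field, antiBrstChar,
    TensorProduct.tmul_add, TensorProduct.tmul_smul, TensorProduct.tmul_smul, one_tmul_bracket_fld,
    ← totalD_one_tmul]
  rfl

theorem antiBrst_comp_gh :
    antiBrst f gc ξ ∘ gh U = -((1 / ξ) • auxB U) + gc • bracket f (agh U) (gh U) := by
  funext a
  rw [Function.comp_apply, antiBrst, gh, evolutionary_lTensor_field, antiBrstChar,
    TensorProduct.tmul_add, TensorProduct.tmul_neg, TensorProduct.tmul_smul,
    TensorProduct.tmul_smul, one_tmul_bracket_fld]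
  rfl

theorem antiBrst_comp_agh : antiBrst f gc ξ ∘ agh U = (gc / 2) • bracket f (agh U) (agh U) := by
  funext a
  rw [Function.comp_apply, antiBrst, agh, evolutionary_lTensor_field, antiBrstChar,
    TensorProduct.tmul_smul, one_tmul_bracket_fld]
  rfl

end Brst

end LocalAlg

section Densities

variable {U : TopologicalSpace.Opens Coord} {ι : Type*}

namespace LorentzMetric

variable (m : LorentzMetric U)

/-- The contraction `g^{μν} F_{μν}` of a family of local expressions with the inverse metric. -/
def contract (F : Fin 4 → Fin 4 → LocalAlg U ι) : LocalAlg U ι :=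
  ∑ μ, ∑ ν, coeff (m.inv μ ν) * F μ ν

theorem contract_add (F G : Fin 4 → Fin 4 → LocalAlg U ι) :
    m.contract (fun μ ν => F μ ν + G μ ν) = m.contract F + m.contract G := by
  simp only [contract, mul_add, Finset.sum_add_distrib]

theorem contract_smul (r : ℝ) (F : Fin 4 → Fin 4 → LocalAlg U ι) :
    m.contract (fun μ ν => r • F μ ν) = r • m.contract F := by
  simp only [contract, mul_smul_comm, Finset.smul_sum]

theorem contract_swap (F : Fin 4 → Fin 4 → LocalAlg U ι) :
    m.contract (fun μ ν => F ν μ) = m.contract F := by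
  rw [contract, Finset.sum_comm]
  simp only [contract, m.inv_symm]

theorem map_contract {D : LocalAlg U ι →ₗ[ℝ] LocalAlg U ι}
    (hD : ∀ h x, D (coeff h * x) = coeff h * D x) (F : Fin 4 → Fin 4 → LocalAlg U ι) :
    D (m.contract F) = m.contract fun μ ν => D (F μ ν) := by
  simp only [contract, map_sum, hD]

end LorentzMetric

variable [Fintype ι] (m : LorentzMetric U) (f : ι → ι → ι → ℝ) (gc ξ : ℝ)

/-- The term `g^{μν} A^a_μ ∂_ν β_a`, which couples the gauge field to a colour vector `β`. -/
def gaugeDeriv (β : ι → LocalAlg U ι) : LocalAlg U ι :=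
  m.contract fun μ ν => A U μ ⬝ᵥ (totalD ν ∘ β)

variable (ι) in
/-- The kinetic term `g^{μν} (∂_μ c̄_a) (∂_ν c^a)` of the ghosts. -/
def ghostKinetic : LocalAlg U ι :=
  m.contract fun μ ν => (totalD μ ∘ agh U) ⬝ᵥ (totalD ν ∘ gh U)

/-- The vertex `g^{μν} f^a_{bc} (∂_μ c̄_a) c^b A^c_ν`. -/
def antighostDerivVertex : LocalAlg U ι :=
  m.contract fun μ ν => (totalD μ ∘ agh U) ⬝ᵥ bracket f (gh U) (A U ν)

/-- The vertex `g^{μν} f^a_{bc} c̄_a (∂_μ c^b) A^c_ν`. -/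
def ghostDerivVertex : LocalAlg U ι :=
  m.contract fun μ ν => agh U ⬝ᵥ bracket f (totalD μ ∘ gh U) (A U ν)

theorem gaugeFixingBoson_eq : gaugeFixingBoson (ι := ι) m ξ =
    coeff m.vol * (-(ξ / 2)) • (m.contract (fun μ ν => A U μ ⬝ᵥ A U ν) - agh U ⬝ᵥ gh U) := by
  simp only [gaugeFixingBoson, LorentzMetric.contract, dotProduct, Finset.mul_sum]

theorem fourGhost_eq :
    fourGhost f = bracket f (agh U) (agh U) ⬝ᵥ bracket f (gh U) (gh U) := by
  simp only [fourGhost, dotProduct, bracket, Finset.sum_mul]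
  simp only [Finset.mul_sum, smul_mul_smul_comm, mul_assoc]

theorem gaugeDeriv_add_smul (β γ : ι → LocalAlg U ι) (r : ℝ) :
    gaugeDeriv m (β + r • γ) = gaugeDeriv m β + r • gaugeDeriv m γ := by
  have totalD_comp (ν : Fin 4) : totalD ν ∘ (β + r • γ) = totalD ν ∘ β + r • (totalD ν ∘ γ) := by
    funext a
    simp
  simp only [gaugeDeriv, totalD_comp, dotProduct_add, dotProduct_smul, m.contract_add,
    m.contract_smul]

theorem gaugeDeriv_bracket (hcyc : ∀ a b c, f a b c = f b c a) :
    gaugeDeriv m (bracket f (agh U) (gh U)) =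
      antighostDerivVertex m f + ghostDerivVertex m f := by
  have rotate (X Y : ι → LocalAlg U ι) (μ : Fin 4) :
      A U μ ⬝ᵥ bracket f X Y = X ⬝ᵥ bracket f Y (A U μ) := by
    rw [HasParity.dotProduct_comm_of_even (hasParity_A μ) Even.zero, bracket_dotProduct hcyc]
  rw [gaugeDeriv, ← m.contract_swap, antighostDerivVertex, ghostDerivVertex, ← m.contract_add]
  simp only [totalD_bracket, dotProduct_add, rotate]

/-! ### The super-BRST variation of the gauge fixing boson -/

theorem antiBrst_A_dotProduct_A (hanti : ∀ a b c, f a c b = -f a b c)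
    (hcyc : ∀ a b c, f a b c = f b c a) (μ ν : Fin 4) :
    antiBrst f gc ξ (A U μ ⬝ᵥ A U ν) =
      (1 / ξ) • (A U ν ⬝ᵥ (totalD μ ∘ agh U) + A U μ ⬝ᵥ (totalD ν ∘ agh U)) := by
  have rotations_cancel : A U μ ⬝ᵥ bracket f (agh U) (A U ν) =
      -(bracket f (agh U) (A U μ) ⬝ᵥ A U ν) := by
    rw [← bracket_dotProduct hcyc, HasParity.bracket_comm hanti (hasParity_A μ) hasParity_agh,
      zero_mul, pow_zero, one_smul, neg_dotProduct]
  rw [(isVerticalDer_antiBrst f gc ξ).map_dotProduct (hasParity_A μ), antiBrst_comp_A,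
    antiBrst_comp_A, add_dotProduct, dotProduct_add, smul_dotProduct, smul_dotProduct,
    dotProduct_smul, dotProduct_smul, rotations_cancel,
    HasParity.dotProduct_comm_of_even (hasParity_A ν) Even.zero (totalD μ ∘ agh U)]
  module

theorem antiBrst_agh_dotProduct_gh (hcyc : ∀ a b c, f a b c = f b c a) :
    antiBrst f gc ξ (agh U ⬝ᵥ gh U) =
      (1 / ξ) • (agh U ⬝ᵥ auxB U) - (gc / 2) • (agh U ⬝ᵥ bracket f (agh U) (gh U)) := by
  rw [(isVerticalDer_antiBrst f gc ξ).map_dotProduct hasParity_agh, antiBrst_comp_agh,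
    antiBrst_comp_gh, smul_dotProduct, bracket_dotProduct hcyc, dotProduct_add, dotProduct_neg,
    dotProduct_smul, dotProduct_smul]
  module

theorem antiBrst_gaugeFixingBoson (hξ : ξ ≠ 0) (hanti : ∀ a b c, f a c b = -f a b c)
    (hcyc : ∀ a b c, f a b c = f b c a) :
    antiBrst f gc ξ (gaugeFixingBoson m ξ) =
      coeff m.vol * (-gaugeDeriv m (agh U) + (1 / 2 : ℝ) • (agh U ⬝ᵥ auxB U)
        - (gc * ξ / 4) • (agh U ⬝ᵥ bracket f (agh U) (gh U))) := by
  have hD := isVerticalDer_antiBrst (U := U) f gc ξ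
  have contract_A : antiBrst f gc ξ (m.contract fun μ ν => A U μ ⬝ᵥ A U ν) =
      (2 / ξ) • gaugeDeriv m (agh U) := by
    rw [m.map_contract hD.map_coeff_mul]
    simp only [antiBrst_A_dotProduct_A f gc ξ hanti hcyc]
    rw [m.contract_smul, m.contract_add,
      m.contract_swap fun μ ν => A U μ ⬝ᵥ (totalD ν ∘ agh U), gaugeDeriv]
    module
  rw [gaugeFixingBoson_eq, hD.map_coeff_mul, map_smul, map_sub, contract_A,
    antiBrst_agh_dotProduct_gh f gc ξ hcyc]
  congr 1
  match_scalars <;> field_simp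
  ring

theorem brst_gaugeDeriv_agh :
    brst f gc ξ (gaugeDeriv m (agh U)) =
      (1 / ξ) • gaugeDeriv m (auxB U) + (-(1 / ξ)) • ghostKinetic ι m
        + (-gc) • antighostDerivVertex m f := by
  have hD := isVerticalDer_brst (U := U) f gc ξ
  have summand (μ ν : Fin 4) : brst f gc ξ (A U μ ⬝ᵥ (totalD ν ∘ agh U)) =
      (1 / ξ) • (A U μ ⬝ᵥ (totalD ν ∘ auxB U))
        + (-(1 / ξ)) • ((totalD ν ∘ agh U) ⬝ᵥ (totalD μ ∘ gh U))
        + (-gc) • ((totalD ν ∘ agh U) ⬝ᵥ bracket f (gh U) (A U μ)) := by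
    have hasParity_totalD_agh := HasParity.totalD_comp (hasParity_agh (U := U) (ι := ι)) ν
    rw [hD.map_dotProduct (hasParity_A μ), brst_comp_A, brst_comp_totalD_agh, add_dotProduct,
      smul_dotProduct, smul_dotProduct, dotProduct_smul,
      HasParity.dotProduct_comm (HasParity.totalD_comp hasParity_gh μ) hasParity_totalD_agh,
      HasParity.dotProduct_comm (HasParity.bracket hasParity_gh (hasParity_A μ))
        hasParity_totalD_agh]
    module
  rw [gaugeDeriv, m.map_contract hD.map_coeff_mul]
  simp only [summand]
  rw [m.contract_add, m.contract_add, m.contract_smul, m.contract_smul, m.contract_smul,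
    m.contract_swap fun μ ν => (totalD μ ∘ agh U) ⬝ᵥ (totalD ν ∘ gh U),
    m.contract_swap fun μ ν => (totalD μ ∘ agh U) ⬝ᵥ bracket f (gh U) (A U ν)]
  rfl

theorem brst_agh_dotProduct_auxB :
    brst f gc ξ (agh U ⬝ᵥ auxB U) = (1 / ξ) • (auxB U ⬝ᵥ auxB U) := by
  rw [(isVerticalDer_brst f gc ξ).map_dotProduct hasParity_agh, brst_comp_agh, brst_comp_auxB,
    dotProduct_zero, smul_zero, add_zero, smul_dotProduct]

theorem brst_agh_dotProduct_bracket (hanti : ∀ a b c, f a c b = -f a b c)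
    (hcyc : ∀ a b c, f a b c = f b c a) :
    brst f gc ξ (agh U ⬝ᵥ bracket f (agh U) (gh U)) =
      (2 / ξ) • (auxB U ⬝ᵥ bracket f (agh U) (gh U)) + (gc / 2) • fourGhost f := by
  have hD := isVerticalDer_brst (U := U) f gc ξ
  have rotate : agh U ⬝ᵥ bracket f (auxB U) (gh U) =
      -(auxB U ⬝ᵥ bracket f (agh U) (gh U)) := by
    rw [← bracket_dotProduct hcyc, HasParity.bracket_comm hanti hasParity_agh hasParity_auxB,
      mul_zero, pow_zero, one_smul, neg_dotProduct, bracket_dotProduct hcyc]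
  rw [hD.map_dotProduct hasParity_agh, hD.map_bracket hasParity_agh, brst_comp_agh, brst_comp_gh,
    bracket_smul_left, bracket_smul_right, smul_dotProduct, dotProduct_add, dotProduct_smul,
    dotProduct_smul, dotProduct_smul, rotate, fourGhost_eq, bracket_dotProduct hcyc (agh U)]
  module

/-- The density `𝒬 G` with `β` in place of the auxiliary field. -/
def superBrstDensity (β : ι → LocalAlg U ι) : LocalAlg U ι :=
  coeff m.vol *
    ((1 / (2 * ξ)) • (β ⬝ᵥ β) - (1 / ξ) • gaugeDeriv m β
      + (1 / ξ) • ghostKinetic ι m + gc • antighostDerivVertex m f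
      - (gc / 2) • (β ⬝ᵥ bracket f (agh U) (gh U)) - (gc ^ 2 * ξ / 8) • fourGhost f)

theorem superBrst_gaugeFixingBoson (hξ : ξ ≠ 0) (hanti : ∀ a b c, f a c b = -f a b c)
    (hcyc : ∀ a b c, f a b c = f b c a) :
    superBrst f gc ξ (gaugeFixingBoson m ξ) = superBrstDensity m f gc ξ (auxB U) := by
  rw [superBrst, LinearMap.comp_apply, antiBrst_gaugeFixingBoson m f gc ξ hξ hanti hcyc,
    (isVerticalDer_brst f gc ξ).map_coeff_mul, map_sub, map_add, map_neg, map_smul, map_smul,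
    brst_gaugeDeriv_agh, brst_agh_dotProduct_auxB,
    brst_agh_dotProduct_bracket f gc ξ hanti hcyc, superBrstDensity]
  congr 1
  match_scalars <;> field_simp <;> ring

/-! ### The shifted auxiliary field -/

/-- The part of the shifted density that does not contain the auxiliary field. -/
def ghostDensity : LocalAlg U ι :=
  (1 / ξ) • ghostKinetic ι m + (gc / 2) • (antighostDerivVertex m f - ghostDerivVertex m f)
    - (gc ^ 2 * ξ / 16) • fourGhost f

/-- The density `𝒬 G` as a function of the shifted auxiliary field `β`. -/
def shiftedDensity (β : ι → LocalAlg U ι) : LocalAlg U ι :=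
  coeff m.vol *
    ((1 / (2 * ξ)) • (β ⬝ᵥ β) - (1 / ξ) • gaugeDeriv m β + ghostDensity m f gc ξ)

theorem superBrstDensity_shift (hξ : ξ ≠ 0) (hanti : ∀ a b c, f a c b = -f a b c)
    (hcyc : ∀ a b c, f a b c = f b c a)
    (hjac : ∀ e b c d, ∑ a, (f e b a * f a c d + f e c a * f a d b + f e d a * f a b c) = 0)
    (β : ι → LocalAlg U ι) :
    superBrstDensity m f gc ξ (β + (gc * ξ / 2) • bracket f (agh U) (gh U)) =
      shiftedDensity m f gc ξ β := by
  have anticomm {x y : LocalAlg U ι} (hx : HasParity 1 x) (hy : HasParity 1 y) :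
      x * y = -(y * x) := by
    rw [hx.mul_comm_smul hy, mul_one, pow_one, neg_one_smul]
  have bracket_sq := bracket_dotProduct_bracket_of_odd hcyc hanti hjac
    (fun a b => anticomm (hasParity_agh (U := U) a) (hasParity_gh b))
    (fun a b => anticomm (hasParity_gh a) (hasParity_gh b))
  have bracket_dotProduct_comm : bracket f (agh U) (gh U) ⬝ᵥ β = β ⬝ᵥ bracket f (agh U) (gh U) :=
    HasParity.dotProduct_comm_of_even (HasParity.bracket hasParity_agh hasParity_gh) even_two β
  rw [superBrstDensity, shiftedDensity, ghostDensity, gaugeDeriv_add_smul,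
    gaugeDeriv_bracket m f hcyc]
  simp only [add_dotProduct, dotProduct_add, smul_dotProduct, dotProduct_smul,
    bracket_dotProduct_comm, bracket_sq, ← fourGhost_eq]
  congr 1
  match_scalars <;> field_simp <;> ring

end Densities

section Divergence

variable {U : TopologicalSpace.Opens Coord} {ι : Type*} (m : LorentzMetric U)

/-! ### The covariant divergence of the gauge field -/

/-- The covariant divergence `g^{μν} ∇_μ A^a_ν` of the gauge field. -/
def covDiv (a : ι) : LocalAlg U ι :=
  m.contract fun μ ν => totalD μ (A U ν a) - ∑ ρ, coeff (m.christoffel ρ μ ν) * A U ρ a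

theorem lorenz_eq (gc : ℝ) : lorenz (ι := ι) m gc = gc • covDiv m := rfl

theorem covDiv_eq (a : ι) :
    covDiv m a = m.contract (fun μ ν => totalD μ (A U ν a)) -
      ∑ ρ, coeff (∑ μ, ∑ ν, m.inv μ ν * m.christoffel ρ μ ν) * A U ρ a := by
  have christoffel_sum : ∑ ρ, coeff (∑ μ, ∑ ν, m.inv μ ν * m.christoffel ρ μ ν) * A U ρ a =
      ∑ μ, ∑ ν, ∑ ρ, coeff (m.inv μ ν) * (coeff (m.christoffel ρ μ ν) * A U ρ a) := by
    simp only [coeff_sum, coeff_mul, Finset.sum_mul, mul_assoc]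
    rw [Finset.sum_comm]
    exact Finset.sum_congr rfl fun μ _ => Finset.sum_comm
  rw [christoffel_sum]
  simp only [covDiv, LorentzMetric.contract, mul_sub, Finset.sum_sub_distrib, Finset.mul_sum]

theorem hasParity_covDiv (a : ι) : HasParity 0 (covDiv m a) := by
  have parityLoc_A (μ : Fin 4) : parityLoc (A U μ a) = A U μ a := by
    simpa only [HasParity, pow_zero, one_smul] using hasParity_A (U := U) μ a
  have parityLoc_totalD_A (μ ν : Fin 4) : parityLoc (totalD μ (A U ν a)) = totalD μ (A U ν a) := by
    simpa only [HasParity, pow_zero, one_smul] using (hasParity_A (U := U) ν a).totalD μ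
  have parityLoc_coeff (h : SmoothFun U) : parityLoc (coeff h : LocalAlg U ι) = coeff h := by
    simpa only [pow_one] using parityLoc_pow_coeff 1 h
  simp only [HasParity, covDiv, LorentzMetric.contract, map_sum, map_mul, map_sub, parityLoc_coeff,
    parityLoc_A, parityLoc_totalD_A, pow_zero, one_smul]

/-- The vector density `√(-det g) g^{μν} A^a_μ`. -/
def gaugeDensity (ν : Fin 4) (a : ι) : LocalAlg U ι :=
  coeff m.vol * ∑ μ, coeff (m.inv μ ν) * A U μ a

theorem sum_totalD_gaugeDensity (a : ι) :
    ∑ ν, totalD ν (gaugeDensity m ν a) = coeff m.vol * covDiv m a := by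
  have totalD_gaugeDensity (ν : Fin 4) : totalD ν (gaugeDensity m ν a) =
      ∑ μ, coeff (partialDeriv ν (m.vol * m.inv ν μ)) * A U μ a
        + coeff m.vol * ∑ μ, coeff (m.inv ν μ) * totalD ν (A U μ a) := by
    rw [gaugeDensity, Finset.mul_sum, Finset.mul_sum, map_sum, ← Finset.sum_add_distrib]
    refine Finset.sum_congr rfl fun μ _ => ?_
    rw [← mul_assoc, ← coeff_mul, totalD_mul, totalD_coeff, m.inv_symm μ ν, coeff_mul, mul_assoc]
  calc ∑ ν, totalD ν (gaugeDensity m ν a)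
      = ∑ ρ, coeff (∑ ν, partialDeriv ν (m.vol * m.inv ν ρ)) * A U ρ a
          + coeff m.vol * m.contract fun μ ν => totalD μ (A U ν a) := by
        simp only [totalD_gaugeDensity, Finset.sum_add_distrib, ← Finset.mul_sum, coeff_sum,
          Finset.sum_mul, LorentzMetric.contract]
        rw [Finset.sum_comm]
    _ = coeff m.vol * covDiv m a := by
        simp only [m.sum_partialDeriv_vol_mul_inv, coeff_neg, coeff_mul, neg_mul, mul_assoc,
          Finset.sum_neg_distrib, ← Finset.mul_sum]
        rw [covDiv_eq, mul_sub, neg_add_eq_sub]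

variable [Fintype ι]

/-- Integration by parts: the total divergence is that of `√(-det g) g^{μν} A^a_μ β_a`. -/
theorem eqModDiv_add_smul_gaugeDeriv (r : ℝ) (β : ι → LocalAlg U ι) (X : LocalAlg U ι) :
    EqModDiv (coeff m.vol * (X + r • gaugeDeriv m β))
      (coeff m.vol * (X - r • (β ⬝ᵥ covDiv m))) := by
  have sum_totalD_comp : ∑ ν, (totalD ν ∘ gaugeDensity m ν) ⬝ᵥ β =
      coeff m.vol * (β ⬝ᵥ covDiv m) := by
    rw [← HasParity.dotProduct_comm_of_even (hasParity_covDiv m) Even.zero]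
    simp only [dotProduct, Function.comp_apply]
    rw [Finset.sum_comm, Finset.mul_sum]
    simp only [← Finset.sum_mul, sum_totalD_gaugeDensity, mul_assoc]
  have sum_dotProduct : ∑ ν, gaugeDensity m ν ⬝ᵥ (totalD ν ∘ β) =
      coeff m.vol * gaugeDeriv m β := by
    rw [gaugeDeriv, ← m.contract_swap, LorentzMetric.contract, Finset.mul_sum]
    refine Finset.sum_congr rfl fun ν _ => ?_
    simp only [dotProduct, gaugeDensity, Finset.mul_sum, Finset.sum_mul, m.inv_symm ν, mul_assoc]
    exact Finset.sum_comm
  refine ⟨fun ν => r • (gaugeDensity m ν ⬝ᵥ β), ?_⟩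
  simp only [map_smul, ← Finset.smul_sum, totalD_dotProduct, Finset.sum_add_distrib,
    sum_totalD_comp, sum_dotProduct, mul_add, mul_sub, mul_smul_comm]
  module

variable (f : ι → ι → ι → ℝ) (gc ξ : ℝ)

theorem ghostKinetic_eq_sum : ghostKinetic ι m =
    ∑ μ, ∑ ν, ∑ a, coeff (m.inv μ ν) * (totalD μ (agh U a) * totalD ν (gh U a)) := by
  simp only [ghostKinetic, LorentzMetric.contract, dotProduct, Finset.mul_sum, Function.comp_apply]

theorem antighostDerivVertex_eq_sum : antighostDerivVertex m f =
    ∑ μ, ∑ ν, ∑ a, ∑ b, ∑ c,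
      f a b c • (coeff (m.inv μ ν) * (totalD μ (agh U a) * gh U b * A U ν c)) := by
  simp only [antighostDerivVertex, LorentzMetric.contract, dotProduct_bracket_eq_sum,
    Finset.mul_sum, mul_smul_comm, Function.comp_apply]

theorem ghostDerivVertex_eq_sum : ghostDerivVertex m f =
    ∑ μ, ∑ ν, ∑ a, ∑ b, ∑ c,
      f a b c • (coeff (m.inv μ ν) * (agh U a * totalD μ (gh U b) * A U ν c)) := by
  simp only [ghostDerivVertex, LorentzMetric.contract, dotProduct_bracket_eq_sum,
    Finset.mul_sum, mul_smul_comm, Function.comp_apply]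

theorem dotProduct_lorenz (β : ι → LocalAlg U ι) :
    ∑ a, β a * lorenz m gc a = gc • (β ⬝ᵥ covDiv m) :=
  dotProduct_smul gc β (covDiv m)

theorem eqModDiv_auxDensity (hgc : gc ≠ 0) :
    EqModDiv (superBrstDensity m f gc ξ (auxB U)) (auxDensity m f gc ξ) := by
  convert eqModDiv_add_smul_gaugeDeriv m (-(1 / ξ)) (auxB U)
    ((1 / (2 * ξ)) • (auxB U ⬝ᵥ auxB U) + (1 / ξ) • ghostKinetic ι m
      + gc • antighostDerivVertex m f - (gc / 2) • (auxB U ⬝ᵥ bracket f (agh U) (gh U))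
      - (gc ^ 2 * ξ / 8) • fourGhost f) using 1
  · rw [superBrstDensity]
    congr 1
    module
  · have sum_auxB_mul_auxB : ∑ a : ι, auxB U a * auxB U a = auxB U ⬝ᵥ auxB U := rfl
    rw [auxDensity, sum_auxB_mul_auxB, dotProduct_lorenz, ← ghostKinetic_eq_sum,
      ← antighostDerivVertex_eq_sum, ← dotProduct_bracket_eq_sum]
    congr 1
    match_scalars <;> field_simp

theorem eqModDiv_symmetricDensity (hgc : gc ≠ 0) (hξ : ξ ≠ 0) :
    EqModDiv (shiftedDensity m f gc ξ (-covDiv m)) (symmetricDensity m f gc ξ) := by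
  convert eqModDiv_add_smul_gaugeDeriv m (-(1 / ξ)) (-covDiv m)
    ((1 / (2 * ξ)) • (covDiv m ⬝ᵥ covDiv m) + ghostDensity m f gc ξ) using 1
  · rw [shiftedDensity, neg_dotProduct_neg]
    congr 1
    module
  · have sum_lorenz_mul_lorenz :
        ∑ a, lorenz m gc a * lorenz m gc a = gc ^ 2 • (covDiv (ι := ι) m ⬝ᵥ covDiv m) := by
      rw [dotProduct_lorenz, lorenz_eq, smul_dotProduct, smul_smul, sq]
    have sum_vertex : ∑ μ, ∑ ν, ∑ a, ∑ b, ∑ c, f a b c • (coeff (m.inv μ ν) *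
        (totalD μ (agh U a) * gh U b * A U ν c - agh U a * totalD μ (gh U b) * A U ν c)) =
        antighostDerivVertex m f - ghostDerivVertex m f := by
      simp only [antighostDerivVertex_eq_sum, ghostDerivVertex_eq_sum, mul_sub, smul_sub,
        Finset.sum_sub_distrib]
    rw [symmetricDensity, sum_lorenz_mul_lorenz, ← ghostKinetic_eq_sum, sum_vertex, ghostDensity,
      neg_dotProduct]
    congr 1
    match_scalars <;> field_simp
    norm_num

end Divergence

section AuxiliaryField

variable {U : TopologicalSpace.Opens Coord} {ι : Type*}

/-! ### Substitution for the auxiliary field -/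

theorem dotProduct_mem {B : Type*} [Fintype ι] [Ring B] [Algebra ℝ B] {S : Subalgebra ℝ B}
    {X Y : ι → B} (hX : ∀ a, X a ∈ S) (hY : ∀ a, Y a ∈ S) : X ⬝ᵥ Y ∈ S :=
  sum_mem fun a _ => mul_mem (hX a) (hY a)

theorem bracket_mem {B : Type*} [Fintype ι] [Ring B] [Algebra ℝ B] {S : Subalgebra ℝ B}
    {X Y : ι → B} (hX : ∀ a, X a ∈ S) (hY : ∀ a, Y a ∈ S) (f : ι → ι → ι → ℝ) (a : ι) :
    bracket f X Y a ∈ S :=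
  sum_mem fun b _ => sum_mem fun c _ => S.smul_mem (mul_mem (hX b) (hY c)) _

variable (U ι) in
/-- The local expressions that do not contain the auxiliary field or its derivatives. -/
def auxFree : Subalgebra ℝ (LocalAlg U ι) :=
  Algebra.adjoin ℝ (Set.range coeff ∪ (fun u => 1 ⊗ₜ jet u) '' {u : Jet ι | ∀ a, u.1 ≠ .aux a})

section AuxFree

theorem coeff_mem_auxFree (h : SmoothFun U) : coeff h ∈ auxFree U ι :=
  Algebra.subset_adjoin (.inl ⟨h, rfl⟩)

theorem field_mem_auxFree {φ : FieldComp ι} (hφ : ∀ a, φ ≠ .aux a) : field φ ∈ auxFree U ι :=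
  Algebra.subset_adjoin (.inr ⟨(φ, 0), hφ, rfl⟩)

theorem totalD_field_mem_auxFree {φ : FieldComp ι} (hφ : ∀ a, φ ≠ .aux a) (μ : Fin 4) :
    totalD μ (field φ) ∈ auxFree U ι :=
  Algebra.subset_adjoin (.inr ⟨(φ, Pi.single μ 1), hφ, (totalD_field μ φ).symm⟩)

theorem A_mem_auxFree (μ : Fin 4) (a : ι) : A U μ a ∈ auxFree U ι := field_mem_auxFree nofun

theorem gh_mem_auxFree (a : ι) : gh U a ∈ auxFree U ι := field_mem_auxFree nofun

theorem agh_mem_auxFree (a : ι) : agh U a ∈ auxFree U ι := field_mem_auxFree nofun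

variable (m : LorentzMetric U)

theorem LorentzMetric.contract_mem_auxFree {F : Fin 4 → Fin 4 → LocalAlg U ι}
    (hF : ∀ μ ν, F μ ν ∈ auxFree U ι) : m.contract F ∈ auxFree U ι :=
  sum_mem fun μ _ => sum_mem fun ν _ => mul_mem (coeff_mem_auxFree _) (hF μ ν)

theorem covDiv_mem_auxFree (a : ι) : covDiv m a ∈ auxFree U ι :=
  m.contract_mem_auxFree fun μ _ => sub_mem (totalD_field_mem_auxFree nofun μ)
    (sum_mem fun ρ _ => mul_mem (coeff_mem_auxFree _) (A_mem_auxFree ρ a))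

variable [Fintype ι] (f : ι → ι → ι → ℝ) (gc ξ : ℝ)

theorem ghostKinetic_mem_auxFree : ghostKinetic ι m ∈ auxFree U ι :=
  m.contract_mem_auxFree fun μ ν => dotProduct_mem
    (fun _ => totalD_field_mem_auxFree nofun μ) (fun _ => totalD_field_mem_auxFree nofun ν)

theorem antighostDerivVertex_mem_auxFree : antighostDerivVertex m f ∈ auxFree U ι :=
  m.contract_mem_auxFree fun μ ν => dotProduct_mem
    (fun _ => totalD_field_mem_auxFree nofun μ) (bracket_mem gh_mem_auxFree (A_mem_auxFree ν) f)

theorem ghostDerivVertex_mem_auxFree : ghostDerivVertex m f ∈ auxFree U ι :=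
  m.contract_mem_auxFree fun μ ν => dotProduct_mem agh_mem_auxFree
    (bracket_mem (fun _ => totalD_field_mem_auxFree nofun μ) (A_mem_auxFree ν) f)

theorem fourGhost_mem_auxFree : (fourGhost f : LocalAlg U ι) ∈ auxFree U ι := by
  have ghost_bracket_mem := bracket_mem (gh_mem_auxFree (U := U)) gh_mem_auxFree f
  have antighost_bracket_mem := bracket_mem (agh_mem_auxFree (U := U)) agh_mem_auxFree f
  rw [fourGhost_eq]
  exact dotProduct_mem antighost_bracket_mem ghost_bracket_mem

theorem ghostDensity_mem_auxFree : ghostDensity m f gc ξ ∈ auxFree U ι :=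
  (auxFree U ι).sub_mem ((auxFree U ι).add_mem
    ((auxFree U ι).smul_mem (ghostKinetic_mem_auxFree m) _)
    ((auxFree U ι).smul_mem ((auxFree U ι).sub_mem (antighostDerivVertex_mem_auxFree m f)
      (ghostDerivVertex_mem_auxFree m f)) _))
    ((auxFree U ι).smul_mem (fourGhost_mem_auxFree f) _)

end AuxFree

section Substitution

variable (β : ι → evenPart U ι)

theorem substAux_one_tmul_jet (u : Jet ι) :
    substAux β (1 ⊗ₜ jet u : LocalAlg U ι) = substVal β u := by
  rw [substAux_tmul_jet, coeff, ← Algebra.TensorProduct.one_def, one_mul]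

theorem substAux_coeff (h : SmoothFun U) : substAux β (coeff h) = coeff h := by
  rw [substAux, coeff, Algebra.TensorProduct.lift_tmul, map_one, mul_one,
    Algebra.TensorProduct.includeLeft_apply]

theorem substAux_of_mem_auxFree {x : LocalAlg U ι} (hx : x ∈ auxFree U ι) : substAux β x = x := by
  refine Algebra.adjoin_le (S := AlgHom.equalizer (substAux β) (AlgHom.id ℝ _)) ?_ hx
  rintro _ (⟨h, rfl⟩ | ⟨⟨φ, I⟩, hφ, rfl⟩)
  · exact substAux_coeff β h
  · refine (substAux_one_tmul_jet β _).trans ?_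
    cases φ with
    | aux a => exact absurd rfl (hφ a)
    | _ => rfl

theorem substAux_comp_auxB : substAux β ∘ auxB U = fun a => (β a : LocalAlg U ι) := by
  funext a
  rw [Function.comp_apply, auxB, field, fld, substAux_one_tmul_jet, substVal, iterD_zero,
    Module.End.one_apply]

theorem substAux_totalD_auxB (ν : Fin 4) (a : ι) :
    substAux β (totalD ν (auxB U a)) = totalD ν (β a : LocalAlg U ι) := by
  rw [auxB, totalD_field, substAux_one_tmul_jet, substVal, iterD_single]

variable [Fintype ι] (m : LorentzMetric U) (f : ι → ι → ι → ℝ) (gc ξ : ℝ)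

theorem substAux_dotProduct (X Y : ι → LocalAlg U ι) :
    substAux β (X ⬝ᵥ Y) = (substAux β ∘ X) ⬝ᵥ (substAux β ∘ Y) :=
  RingHom.map_dotProduct (substAux β).toRingHom X Y

theorem substAux_gaugeDeriv_auxB :
    substAux β (gaugeDeriv m (auxB U)) = gaugeDeriv m fun a => (β a : LocalAlg U ι) := by
  simp only [gaugeDeriv, LorentzMetric.contract, dotProduct, map_sum, map_mul, substAux_coeff,
    substAux_of_mem_auxFree β (A_mem_auxFree _ _), Function.comp_apply, substAux_totalD_auxB]

theorem substAux_superBrstDensity :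
    substAux β (superBrstDensity m f gc ξ (auxB U)) =
      superBrstDensity m f gc ξ fun a => (β a : LocalAlg U ι) := by
  have substAux_bracket : substAux β ∘ bracket f (agh U) (gh U) = bracket f (agh U) (gh U) :=
    funext fun a => substAux_of_mem_auxFree β (bracket_mem agh_mem_auxFree gh_mem_auxFree f a)
  simp only [superBrstDensity, map_mul, map_add, map_sub, map_smul, substAux_coeff,
    substAux_dotProduct, substAux_comp_auxB, substAux_bracket, substAux_gaugeDeriv_auxB,
    substAux_of_mem_auxFree β (ghostKinetic_mem_auxFree m),
    substAux_of_mem_auxFree β (antighostDerivVertex_mem_auxFree m f),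
    substAux_of_mem_auxFree β (fourGhost_mem_auxFree f)]

theorem substAux_shiftedDensity :
    substAux β (shiftedDensity m f gc ξ (auxB U)) =
      shiftedDensity m f gc ξ fun a => (β a : LocalAlg U ι) := by
  simp only [shiftedDensity, map_mul, map_add, map_sub, map_smul, substAux_coeff,
    substAux_dotProduct, substAux_comp_auxB, substAux_gaugeDeriv_auxB,
    substAux_of_mem_auxFree β (ghostDensity_mem_auxFree m f gc ξ)]

theorem shift_shiftedAux (a : ι) : shift f gc ξ (shiftedAux f gc ξ a) = auxB U a := by
  rw [shift, shiftedAux, map_sub, map_smul,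
    substAux_of_mem_auxFree _ (bracket_mem agh_mem_auxFree gh_mem_auxFree f a),
    ← Function.comp_apply (f := substAux _), substAux_comp_auxB, add_sub_cancel_right]

theorem shift_superBrstDensity (hξ : ξ ≠ 0) (hanti : ∀ a b c, f a c b = -f a b c)
    (hcyc : ∀ a b c, f a b c = f b c a)
    (hjac : ∀ e b c d, ∑ a, (f e b a * f a c d + f e c a * f a d b + f e d a * f a b c) = 0) :
    shift f gc ξ (superBrstDensity m f gc ξ (auxB U)) = shiftedDensity m f gc ξ (auxB U) := by
  rw [shift, substAux_superBrstDensity]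
  exact superBrstDensity_shift m f gc ξ hξ hanti hcyc hjac (auxB U)

end Substitution

/-! ### The Euler–Lagrange equation of the auxiliary field -/

theorem isVerticalDer_auxPartial (a : ι) (I : Fin 4 → ℕ) :
    IsVerticalDer 0 (auxPartial (U := U) a I) :=
  isVerticalDer_superDer 0 _ _

open Classical in
theorem auxPartial_one_tmul_jet (a : ι) (I : Fin 4 → ℕ) (u : Jet ι) :
    auxPartial a I (1 ⊗ₜ jet u : LocalAlg U ι) = if u = (.aux a, I) then 1 else 0 := by
  rw [auxPartial, LinearMap.lTensor_tmul, superDer_jet]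
  split_ifs
  · rfl
  · exact TensorProduct.tmul_zero _ _

theorem auxPartial_of_mem_auxFree (a : ι) (I : Fin 4 → ℕ) {x : LocalAlg U ι}
    (hx : x ∈ auxFree U ι) : auxPartial a I x = 0 := by
  have hD := isVerticalDer_auxPartial (U := U) a I
  have auxPartial_one : auxPartial a I (1 : LocalAlg U ι) = 0 := hD.map_coeff 1
  induction hx using Algebra.adjoin_induction with
  | mem x hx =>
    obtain ⟨h, rfl⟩ | ⟨u, hu, rfl⟩ := hx
    · exact hD.map_coeff h
    · exact (auxPartial_one_tmul_jet a I u).trans (if_neg fun h => hu a (congrArg Prod.fst h))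
  | algebraMap r => rw [Algebra.algebraMap_eq_smul_one, map_smul, auxPartial_one, smul_zero]
  | add x y _ _ hx hy => rw [map_add, hx, hy, add_zero]
  | mul x y _ _ hx hy => rw [hD.map_mul, hx, hy, zero_mul, mul_zero, add_zero]

open Classical in
theorem auxPartial_comp_auxB (a : ι) (I : Fin 4 → ℕ) :
    auxPartial a I ∘ auxB U = if I = 0 then Pi.single a 1 else 0 := by
  funext b
  refine (auxPartial_one_tmul_jet a I _).trans ?_
  split_ifs <;> simp_all

open Classical in
theorem auxPartial_comp_totalD_auxB (a : ι) (I : Fin 4 → ℕ) (ν : Fin 4) :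
    auxPartial a I ∘ (totalD ν ∘ auxB U) = if I = Pi.single ν 1 then Pi.single a 1 else 0 := by
  funext b
  rw [Function.comp_apply, Function.comp_apply, auxB, totalD_field, auxPartial_one_tmul_jet]
  split_ifs <;> simp_all

open Classical in
theorem eulerAux_of_first_order {a : ι} {X : LocalAlg U ι} (X₀ : LocalAlg U ι)
    (X₁ : Fin 4 → LocalAlg U ι)
    (hX : ∀ I, auxPartial a I X =
      (if I = 0 then X₀ else 0) + ∑ ν, if I = Pi.single ν 1 then X₁ ν else 0) :
    eulerAux a X = X₀ - ∑ ν, totalD ν (X₁ ν) := by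
  have finsum_ite (J : Fin 4 → ℕ) (Y : LocalAlg U ι) : (∑ᶠ I, if I = J then Y else 0) = Y := by
    rw [finsum_eq_single _ J fun I hI => if_neg hI, if_pos rfl]
  have finite_support (J : Fin 4 → ℕ) (Y : LocalAlg U ι) :
      (Function.support fun I => if I = J then Y else 0).Finite :=
    (Set.finite_singleton J).subset fun I hI => of_not_not fun hIJ => hI (if_neg hIJ)
  have summand (I : Fin 4 → ℕ) : (-1 : ℝ) ^ (∑ μ, I μ) • iterD totalD I (auxPartial a I X) =
      (if I = 0 then X₀ else 0) + ∑ ν, if I = Pi.single ν 1 then -totalD ν (X₁ ν) else 0 := by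
    rw [hX, map_add, map_sum, smul_add, Finset.smul_sum]
    congr 1
    · split_ifs with hI <;> simp [hI, iterD_zero]
    · refine Finset.sum_congr rfl fun ν _ => ?_
      split_ifs with hI <;> simp [hI, iterD_single]
  rw [eulerAux, finsum_congr summand, finsum_add_distrib (finite_support _ _), finsum_ite,
    finsum_sum_comm _ _ fun ν _ => finite_support _ _]
  · simp only [finsum_ite, Finset.sum_neg_distrib, sub_eq_add_neg]
  · exact Function.HasFiniteSupport.sum (fun ν => finite_support _ _) _

variable [Fintype ι] (m : LorentzMetric U) (f : ι → ι → ι → ℝ) (gc ξ : ℝ)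

open Classical in
theorem auxPartial_auxB_dotProduct_auxB (a : ι) (I : Fin 4 → ℕ) :
    auxPartial a I (auxB U ⬝ᵥ auxB U) = if I = 0 then (2 : ℝ) • auxB U a else 0 := by
  rw [(isVerticalDer_auxPartial a I).map_dotProduct hasParity_auxB, auxPartial_comp_auxB]
  split_ifs <;> simp [two_smul]

open Classical in
theorem vol_mul_auxPartial_gaugeDeriv_auxB (a : ι) (I : Fin 4 → ℕ) :
    coeff m.vol * auxPartial a I (gaugeDeriv m (auxB U)) =
      ∑ ν, if I = Pi.single ν 1 then gaugeDensity m ν a else 0 := by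
  have hD := isVerticalDer_auxPartial (U := U) a I
  have summand (μ ν : Fin 4) : auxPartial a I (A U μ ⬝ᵥ (totalD ν ∘ auxB U)) =
      if I = Pi.single ν 1 then A U μ a else 0 := by
    have auxPartial_comp_A : auxPartial a I ∘ A U μ = 0 :=
      funext fun b => auxPartial_of_mem_auxFree a I (A_mem_auxFree μ b)
    rw [hD.map_dotProduct (hasParity_A μ), auxPartial_comp_A, auxPartial_comp_totalD_auxB]
    split_ifs <;> simp
  rw [gaugeDeriv, m.map_contract hD.map_coeff_mul, LorentzMetric.contract, Finset.sum_comm,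
    Finset.mul_sum]
  refine Finset.sum_congr rfl fun ν _ => ?_
  simp only [summand, gaugeDensity]
  split_ifs <;> simp

theorem eulerAux_shiftedDensity (hξ : ξ ≠ 0) (a : ι) :
    eulerAux a (shiftedDensity m f gc ξ (auxB U)) =
      (1 / ξ) • (coeff m.vol * (auxB U a + covDiv m a)) := by
  classical
  rw [eulerAux_of_first_order ((1 / ξ) • (coeff m.vol * auxB U a))
    fun ν => -((1 / ξ) • gaugeDensity m ν a)]
  · simp only [map_neg, map_smul, Finset.sum_neg_distrib, ← Finset.smul_sum,
      sum_totalD_gaugeDensity, sub_neg_eq_add, mul_add, smul_add]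
  · intro I
    rw [shiftedDensity, (isVerticalDer_auxPartial a I).map_coeff_mul, map_add, map_sub, map_smul,
      map_smul, auxPartial_of_mem_auxFree a I (ghostDensity_mem_auxFree m f gc ξ), add_zero,
      mul_sub, mul_smul_comm, mul_smul_comm, vol_mul_auxPartial_gaugeDeriv_auxB,
      auxPartial_auxB_dotProduct_auxB, sub_eq_add_neg, Finset.smul_sum, ← Finset.sum_neg_distrib]
    congr 1
    · split_ifs
      · rw [mul_smul_comm, smul_smul]
        congr 1
        field_simp
      · rw [mul_zero, smul_zero]
    · refine Finset.sum_congr rfl fun ν _ => ?_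
      split_ifs <;> simp

theorem substAux_eulerAux_eq_zero_iff (hξ : ξ ≠ 0) (β : ι → evenPart U ι) (a : ι) :
    substAux β (eulerAux a (shiftedDensity m f gc ξ (auxB U))) = 0 ↔
      (β a : LocalAlg U ι) = -covDiv m a := by
  have substAux_auxB : substAux β (auxB U a) = β a := congrFun (substAux_comp_auxB β) a
  rw [eulerAux_shiftedDensity m f gc ξ hξ, map_smul, map_mul, map_add, substAux_coeff,
    substAux_auxB, substAux_of_mem_auxFree β (covDiv_mem_auxFree m a),
    smul_eq_zero_iff_right (one_div_ne_zero hξ), (isUnit_coeff m.isUnit_vol).mul_right_eq_zero,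
    add_eq_zero_iff_eq_neg]

end AuxiliaryField

end QYM

end

theorem mainTheorem2
    {U : TopologicalSpace.Opens QYM.Coord} (m : QYM.LorentzMetric U)
    {𝔤 : Type*} [LieRing 𝔤] [LieAlgebra ℝ 𝔤] {ι : Type*} [Fintype ι] (T : Module.Basis ι ℝ 𝔤)
    (hT : ∀ x y z : 𝔤, QYM.colorMetric T ⁅x, y⁆ z = -QYM.colorMetric T y ⁅x, z⁆)
    (gc ξ : ℝ) (hgc : gc ≠ 0) (hξ : ξ ≠ 0)
    (f : ι → ι → ι → ℝ) (hf : f = QYM.structureConst T)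
    (QG : QYM.LocalAlg U ι) (hQG : QG = QYM.superBrst f gc ξ (QYM.gaugeFixingBoson m ξ)) :
    -- the density with the auxiliary field
    QYM.EqModDiv QG (QYM.auxDensity m f gc ξ) ∧
    -- the change of variables to the shifted auxiliary field
    (∀ a, QYM.shift f gc ξ (QYM.shiftedAux f gc ξ a) = QYM.auxB U a) ∧
    -- the equation of motion of the shifted auxiliary field has the unique solution `-L^a / gc`
    (∀ β : ι → QYM.evenPart U ι,
      (∀ a, QYM.substAux β (QYM.eulerAux a (QYM.shift f gc ξ QG)) = 0) ↔
        ∀ a, (β a : QYM.LocalAlg U ι) = -((1 / gc) • QYM.lorenz m gc a)) ∧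
    -- inserting a solution yields the symmetric density, and a solution exists
    (∃ β : ι → QYM.evenPart U ι,
      (∀ a, QYM.substAux β (QYM.eulerAux a (QYM.shift f gc ξ QG)) = 0) ∧
      QYM.EqModDiv (QYM.substAux β (QYM.shift f gc ξ QG)) (QYM.symmetricDensity m f gc ξ)) := by
  subst hf
  have hanti := QYM.structureConst_swap T
  have hcyc := QYM.structureConst_cyclic T hT
  have hjac := QYM.structureConst_jacobi T
  have hvariation : QG = QYM.superBrstDensity m (QYM.structureConst T) gc ξ (QYM.auxB U) :=
    hQG.trans (QYM.superBrst_gaugeFixingBoson m _ gc ξ hξ hanti hcyc)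
  have hshift : QYM.shift (QYM.structureConst T) gc ξ QG =
      QYM.shiftedDensity m (QYM.structureConst T) gc ξ (QYM.auxB U) := by
    rw [hvariation, QYM.shift_superBrstDensity m _ gc ξ hξ hanti hcyc hjac]
  have hlorenz (a : ι) : (1 / gc) • QYM.lorenz m gc a = QYM.covDiv m a := by
    rw [QYM.lorenz_eq, Pi.smul_apply, smul_smul, one_div_mul_cancel hgc, one_smul]
  have hmotion (β : ι → QYM.evenPart U ι) :
      (∀ a, QYM.substAux β
        (QYM.eulerAux a (QYM.shift (QYM.structureConst T) gc ξ QG)) = 0) ↔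
        ∀ a, (β a : QYM.LocalAlg U ι) = -QYM.covDiv m a := by
    rw [hshift]
    exact forall_congr' fun a => QYM.substAux_eulerAux_eq_zero_iff m _ gc ξ hξ β a
  refine ⟨hvariation ▸ QYM.eqModDiv_auxDensity m _ gc ξ hgc, QYM.shift_shiftedAux _ gc ξ,
    fun β => by simpa only [hlorenz] using hmotion β,
    fun a => ⟨-QYM.covDiv m a, neg_mem ((QYM.hasParity_covDiv m a).mem_evenPart Even.zero)⟩,
    (hmotion _).mpr fun _ => rfl, ?_⟩
  rw [hshift, QYM.substAux_shiftedDensity]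
  exact QYM.eqModDiv_symmetricDensity m _ gc ξ hgc hξ
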